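/- Let $G=(V,E)$ be a finite, simple, connected graph with $|E|\ge 2$ and graph distance $d$. Let $B\subseteq V$ be a (possibly empty) set such that $V^\circ:=V\setminus B$ is nonempty and induces a connected subgraph, and let $\eta\in\{-1,1\}^B$ be a fixed boundary condition. For $J=(J_e)_{e\in E}\in\mathbb{R}^E$ put $$H_J(\sigma):=-\sum_{\{i,j\}\in E}J_{ij}\sigma_i\sigma_j,\qquad \sigma\in\{-1,1\}^V,$$ and call $\sigma$ a ground state in the environment $J$ if it minimizes $H_J$ among all states that agree with $\eta$ on $B$ (for $B=\emptyset$ this is the free boundary condition). Let $J=(J_e)_{e\in E}$ be i.i.d. standard Gaussian random variables, let $J'=(J'_e)_{e\in E}$ be an independent copy of $J$, and let $p\in(0,1)$. Consider two kinds of perturbed environment $J^{(p)}$: 1. $J^{(p)}_e:=(1-p)J_e+\sqrt{2p-p^2}\,J'_e$ for all $e\in E$; 2. each $J_e$ is replaced by $J'_e$ with probability $p$ and left unchanged otherwise, independently over the edges $e\in E$ and independently of $(J,J')$. Let $\sigma$ be a ground state in the environment $J$ and $\sigma'$ a ground state in the environment $J^{(p)}$, both under the same boundary condition. These are almost surely unique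 if $B\neq\emptyset$, and almost surely unique up to a global sign if $B=\emptyset$. Let $$R(p):=\frac{1}{|V^\circ|}\sum_{i\in V^\circ}\sigma_i\sigma'_i ;$$ thus $R(p)^2$ is almost surely well defined in either case. Suppose that $\alpha,\beta,\gamma,\delta$ are positive constants such that for all $i\in V^\circ$ and all real $r\ge 1$, $$|\{j\in V: d(i,j)\le r\}|\le \alpha r^\beta ,\qquad |\{j\in V: \min_{k\in B} d(j,k)\le r\}|\le \gamma |B| r^\delta ,$$ where the minimum over the empty set is $+\infty$. Then, for both kinds of perturbation and every $p\in(0,1)$, $$\mathbb{E}\bigl(R(p)^2\bigr)\le \frac{1}{|V^\circ|}+\frac{C\,\bigl(|V^\circ|\,p^{-\beta}+|B|^2p^{-2\delta}\bigr)}{|V^\circ|^2},$$ where $C$ is a constant depending only on $\alpha$, $\beta$, $\gamma$ and $\delta$. -/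

import Mathlib

open MeasureTheory ProbabilityTheory

namespace EdwardsAnderson

/-- The Edwards-Anderson Hamiltonian `H_J(σ) = - ∑_{{i,j} ∈ E} J_{ij} σ_i σ_j`; the spin space
`{-1,1}` is the group of units `ℤˣ`. -/
noncomputable def hamiltonian {V : Type*} (G : SimpleGraph V) [Fintype G.edgeSet]
    (J : G.edgeSet → ℝ) (σ : V → ℤˣ) : ℝ :=
  -∑ e : G.edgeSet, J e * ((((e : Sym2 V).map σ).mul : ℤ) : ℝ)

/-- `σ` is a ground state in the environment `J` under the boundary condition `η` on `B`: it agrees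
with `η` on `B` and minimizes the Hamiltonian among the states that do. For `B = ∅` this is the
free boundary condition. -/
def IsGroundState {V : Type*} (G : SimpleGraph V) [Fintype G.edgeSet] (B : Finset V)
    (η : B → ℤˣ) (J : G.edgeSet → ℝ) (σ : V → ℤˣ) : Prop :=
  (∀ i : B, σ i = η i) ∧
    ∀ τ : V → ℤˣ, (∀ i : B, τ i = η i) → hamiltonian G J σ ≤ hamiltonian G J τ

/-- The site overlap `|V°|⁻¹ ∑_{i ∈ V°} σ_i σ'_i` of two states, where `V° = V \ B`. -/
noncomputable def siteOverlap {V : Type*} [Fintype V] [DecidableEq V] (B : Finset V)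
    (σ σ' : V → ℤˣ) : ℝ :=
  (1 / (Bᶜ.card : ℝ)) * ∑ i ∈ Bᶜ, ((σ i : ℤ) : ℝ) * ((σ' i : ℤ) : ℝ)

/-- The law of a family of i.i.d. standard Gaussian variables indexed by `E`. -/
noncomputable def gaussianDisorder (E : Type*) [Fintype E] : Measure (E → ℝ) :=
  Measure.pi fun _ => gaussianReal 0 1

/-- The law of a family of i.i.d. Bernoulli variables indexed by `E`, equal to `true` with
probability `p`. -/
noncomputable def bernoulliSelection (E : Type*) [Fintype E] (p : unitInterval) :
    Measure (E → Bool) :=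
  Measure.pi fun _ => bernoulliMeasure true false p

/-- First kind of perturbation: `J` is i.i.d. standard Gaussian, and
`J^{(p)}_e = (1 - p) J_e + √(2p - p²) J'_e` with `J'` an independent copy of `J`. -/
def IsGaussianPerturbation {Ω E : Type*} [MeasurableSpace Ω] [Fintype E] (P : Measure Ω)
    (p : unitInterval) (J Jp : Ω → E → ℝ) : Prop :=
  ∃ J' : Ω → E → ℝ,
    HasLaw (fun ω => (J ω, J' ω)) ((gaussianDisorder E).prod (gaussianDisorder E)) P ∧
    ∀ ω e, Jp ω e = (1 - (p : ℝ)) * J ω e + √(2 * (p : ℝ) - (p : ℝ) ^ 2) * J' ω e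

/-- Second kind of perturbation: `J` is i.i.d. standard Gaussian, and each `J_e` is replaced with
probability `p`, independently over the edges, by `J'_e`, with `J'` an independent copy of `J`;
the edges where this happens are independent of `(J, J')`. -/
def IsResamplingPerturbation {Ω E : Type*} [MeasurableSpace Ω] [Fintype E] (P : Measure Ω)
    (p : unitInterval) (J Jp : Ω → E → ℝ) : Prop :=
  ∃ (J' : Ω → E → ℝ) (ξ : Ω → E → Bool),
    HasLaw (fun ω => (J ω, J' ω, ξ ω))
      ((gaussianDisorder E).prod ((gaussianDisorder E).prod (bernoulliSelection E p))) P ∧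
    ∀ ω e, Jp ω e = if ξ ω e = true then J' ω e else J ω e

end EdwardsAnderson

/-! Expanding the square, `𝔼 R(p)²` is the average over interior pairs `i, j` of the correlation
between `σ_i σ_j` in the environment `J` and the same product in `J^(p)`. Each such correlation is
bounded by `(1 - p)^m` with `m = min (d(i,j)) (max (d(i,B)) (d(j,B)))`.

The reason is gauge symmetry. A set `S` of fewer than `m` edges cannot connect one chosen endpoint
to the other endpoint or to `B`. Reversing the spins in the component of that endpoint in the graph
`(V, S)` changes signs of couplings outside `S` only, respects the boundary condition, and turns
`σ_i σ_j` into its negative (`flipsOffSmallSets_twoPoint`). So no contribution involving fewer than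
`m` coordinates survives in an expansion of the correlation `φ(ρ)`, `ρ = 1 - p`, and `φ(ρ) = O(ρ^m)`
as `ρ → 0`.

The constant in this estimate depends on the graph, and no spectral decomposition is used to remove
it. Instead, conditional independence and the semigroup property of the noise give `φ(ρ)² ≤ φ(ρ²)`
(`corr_sq_le`); iterating along `ρ^(2^n)` forces the constant down to one (`le_pow_of_sq_le`).

Finally `(1 - p)^m ≤ exp (-p d(i,j)) + exp (-p d(i,B)/2) exp (-p d(j,B)/2)`, and polynomial growth
bounds the sums of the two terms by multiples of `|V°| p^(-β)` and `|B|² p^(-2δ)`. -/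

namespace EdwardsAnderson

/-! ### Product measures and their densities. -/

section ProductMeasures

variable {E : Type*} [Fintype E]

/-- The law of coordinatewise functions of two independent families with independent
coordinates. -/
theorem map_pi_prod_pi {A A' C : Type*} [MeasurableSpace A] [MeasurableSpace A']
    [MeasurableSpace C] (μ : Measure A) (ν : Measure A') [IsProbabilityMeasure μ]
    [IsProbabilityMeasure ν] {g : A × A' → C} (hg : Measurable g) :
    ((Measure.pi fun _ : E => μ).prod (Measure.pi fun _ : E => ν)).map
      (fun z e => g (z.1 e, z.2 e)) = Measure.pi fun _ : E => (μ.prod ν).map g := by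
  have : IsProbabilityMeasure ((μ.prod ν).map g) :=
    Measure.isProbabilityMeasure_map hg.aemeasurable
  rw [← (measurePreserving_arrowProdEquivProdArrow A A' E (fun _ => μ) (fun _ => ν)).map_eq,
    Measure.map_map (by fun_prop) (MeasurableEquiv.measurable _),
    ← Measure.pi_map_pi (fun _ => hg.aemeasurable)]
  rfl

/-- On a box this is Fubini for a product of one-coordinate functions, and boxes determine the
product measure. -/
theorem pi_withDensity_ofReal {A : Type*} [MeasurableSpace A] (μ : Measure A)
    [SigmaFinite μ] {g : A → ℝ} (hg : Integrable g μ) (h0 : ∀ a, 0 ≤ g a) :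
    (Measure.pi fun _ : E => μ.withDensity fun a => ENNReal.ofReal (g a)) =
      (Measure.pi fun _ : E => μ).withDensity fun x => ENNReal.ofReal (∏ e, g (x e)) := by
  have : IsFiniteMeasure (μ.withDensity fun a => ENNReal.ofReal (g a)) :=
    isFiniteMeasure_withDensity_ofReal hg.2
  refine Measure.pi_eq fun s hs => ?_
  rw [withDensity_apply _ (MeasurableSet.univ_pi hs)]
  have h1 : ∀ e, (μ.withDensity fun a => ENNReal.ofReal (g a)) (s e) =
      ENNReal.ofReal (∫ a, (s e).indicator g a ∂μ) := fun e => by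
    rw [withDensity_apply _ (hs e), integral_indicator (hs e),
      ofReal_integral_eq_lintegral_ofReal hg.integrableOn (ae_of_all _ h0)]
  simp_rw [h1]
  rw [← ENNReal.ofReal_prod_of_nonneg
    (fun e _ => integral_nonneg fun a => Set.indicator_nonneg (fun a _ => h0 a) a),
    ← integral_fintype_prod_eq_prod (𝕜 := ℝ) (fun e a => (s e).indicator g a),
    ofReal_integral_eq_lintegral_ofReal, ← lintegral_indicator (MeasurableSet.univ_pi hs)]
  · refine lintegral_congr fun x => ?_
    by_cases hx : x ∈ Set.univ.pi s
    · rw [Set.indicator_of_mem hx]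
      congr 1
      exact Finset.prod_congr rfl fun e _ => by
        rw [Set.indicator_of_mem (hx e (Set.mem_univ e))]
    · rw [Set.indicator_of_notMem hx]
      simp only [Set.mem_pi, Set.mem_univ, true_implies, not_forall] at hx
      obtain ⟨e, he⟩ := hx
      rw [Finset.prod_eq_zero (Finset.mem_univ e) (Set.indicator_of_notMem he _),
        ENNReal.ofReal_zero]
  · exact Integrable.fintype_prod (fun e => hg.indicator (hs e))
  · exact ae_of_all _ fun x =>
      Finset.prod_nonneg fun e _ => Set.indicator_nonneg (fun a _ => h0 a) _

end ProductMeasures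

/-! ### Correlations of coordinatewise coupled families. -/

section Correlation

variable {E : Type*} [Fintype E]

/-- The correlation `𝔼 f(X) f(Y)`, where the pairs `(X_e, Y_e)` are independent with law `m`. -/
noncomputable def corr (f : (E → ℝ) → ℝ) (m : Measure (ℝ × ℝ)) : ℝ :=
  ∫ w : E → ℝ × ℝ, f (fun e => (w e).1) * f (fun e => (w e).2) ∂Measure.pi fun _ => m

theorem corr_map {A A' : Type*} [MeasurableSpace A] [MeasurableSpace A'] (μ : Measure A)
    (ν : Measure A') [IsProbabilityMeasure μ] [IsProbabilityMeasure ν] {g : A × A' → ℝ × ℝ}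
    (hg : Measurable g) {f : (E → ℝ) → ℝ} (hf : Measurable f) :
    corr f ((μ.prod ν).map g) =
      ∫ z : (E → A) × (E → A'), f (fun e => (g (z.1 e, z.2 e)).1) *
        f (fun e => (g (z.1 e, z.2 e)).2)
        ∂(Measure.pi fun _ => μ).prod (Measure.pi fun _ => ν) := by
  rw [corr, ← map_pi_prod_pi μ ν hg, integral_map]
  · exact (by fun_prop : Measurable _).aemeasurable
  · exact (by fun_prop : Measurable _).aestronglyMeasurable

theorem integrable_of_abs_le_one {Ω : Type*} [MeasurableSpace Ω] {P : Measure Ω}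
    [IsFiniteMeasure P] {f : Ω → ℝ} (hf : Measurable f) (h1 : ∀ x, |f x| ≤ 1) :
    Integrable f P :=
  Integrable.of_bound hf.aestronglyMeasurable 1 (ae_of_all _ h1)

theorem abs_mul_le_one {a b : ℝ} (ha : |a| ≤ 1) (hb : |b| ≤ 1) : |a * b| ≤ 1 := by
  rw [abs_mul]; exact mul_le_one₀ ha (abs_nonneg b) hb

/-- If `Y` and `Y'` are conditionally i.i.d. given `X`, then
`(𝔼 f(X) f(Y))² ≤ 𝔼 f(Y) f(Y')` for `|f| ≤ 1`. -/
theorem corr_sq_le {U : Type*} [MeasurableSpace U] (μ : Measure ℝ) (ν : Measure U)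
    [IsProbabilityMeasure μ] [IsProbabilityMeasure ν] {k : ℝ × U → ℝ} (hk : Measurable k)
    {f : (E → ℝ) → ℝ} (hf : Measurable f) (h1 : ∀ x, |f x| ≤ 1) :
    corr f ((μ.prod ν).map fun z => (z.1, k z)) ^ 2 ≤
      corr f ((μ.prod (ν.prod ν)).map fun z => (k (z.1, z.2.1), k (z.1, z.2.2))) := by
  rw [corr_map μ ν (by fun_prop) hf]
  -- Two independent families of noises are regrouped from one family of pairs.
  have h3 : corr f ((μ.prod (ν.prod ν)).map fun z => (k (z.1, z.2.1), k (z.1, z.2.2))) =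
      ∫ z : (E → ℝ) × (E → U) × (E → U), f (fun e => k (z.1 e, z.2.1 e)) *
        f (fun e => k (z.1 e, z.2.2 e))
        ∂(Measure.pi fun _ => μ).prod ((Measure.pi fun _ => ν).prod (Measure.pi fun _ => ν)) := by
    rw [corr_map μ (ν.prod ν) (by fun_prop) hf]
    have := map_pi_prod_pi (E := E) ν ν (g := id) measurable_id
    rw [Measure.map_id] at this
    rw [← this, ← Measure.map_id (μ := Measure.pi fun _ : E => μ),
      Measure.map_prod_map _ _ measurable_id (by fun_prop), integral_map, Measure.map_id]
    · rfl
    · exact (by fun_prop : Measurable _).aemeasurable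
    · exact (by fun_prop : Measurable _).aestronglyMeasurable
  rw [h3]
  set γ := Measure.pi fun _ : E => μ
  set ν' := Measure.pi fun _ : E => ν
  set F : (E → ℝ) × (E → U) → ℝ := fun z => f (fun e => k (z.1 e, z.2 e)) with hF
  have hFm : Measurable F := by fun_prop
  have hF1 : ∀ z, |F z| ≤ 1 := fun z => h1 _
  set g : (E → ℝ) → ℝ := fun x => ∫ u, F (x, u) ∂ν' with hg
  have hgm : Measurable g := (hFm.stronglyMeasurable.integral_prod_right).measurable
  have hg1 : ∀ x, |g x| ≤ 1 := fun x => by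
    have := norm_integral_le_of_norm_le_const (μ := ν') (f := fun u => F (x, u)) (C := 1)
      (ae_of_all _ fun u => hF1 _)
    simpa using this
  have e1 : ∫ z : (E → ℝ) × (E → U), f (fun e => z.1 e) * f (fun e => k (z.1 e, z.2 e))
      ∂γ.prod ν' = ∫ x, f x * g x ∂γ := by
    rw [integral_prod]
    · simp_rw [hg, ← integral_const_mul]; rfl
    · exact integrable_of_abs_le_one (by fun_prop) fun z => abs_mul_le_one (h1 _) (h1 _)
  have e2 : ∫ z : (E → ℝ) × (E → U) × (E → U), f (fun e => k (z.1 e, z.2.1 e)) *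
      f (fun e => k (z.1 e, z.2.2 e)) ∂γ.prod (ν'.prod ν') = ∫ x, g x * g x ∂γ := by
    rw [integral_prod]
    · refine integral_congr_ae (ae_of_all _ fun x => ?_)
      exact integral_prod_mul (μ := ν') (ν := ν') (fun u => F (x, u)) (fun u => F (x, u))
    · exact integrable_of_abs_le_one (by fun_prop) fun z => abs_mul_le_one (h1 _) (h1 _)
  change (∫ z : (E → ℝ) × (E → U), f (fun e => z.1 e) * f (fun e => k (z.1 e, z.2 e))
      ∂γ.prod ν') ^ 2 ≤ _
  rw [e1, e2]
  set t := ∫ x, f x * g x ∂γ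
  have i1 : Integrable (fun x => g x * g x) γ :=
    integrable_of_abs_le_one (by fun_prop) fun z => abs_mul_le_one (hg1 _) (hg1 _)
  have i2 : Integrable (fun x => f x * g x) γ :=
    integrable_of_abs_le_one (by fun_prop) fun z => abs_mul_le_one (h1 _) (hg1 _)
  -- Cauchy–Schwarz by hand: the integrand is `(g - t f)² + t² (1 - f²)`, and its integral is `∫ g²
  -- - t²`.
  have h0 : 0 ≤ ∫ x, (t ^ 2 - 2 * t * (f x * g x) + g x * g x) ∂γ := by
    refine integral_nonneg_of_ae (ae_of_all _ fun x => ?_)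
    have : f x ^ 2 ≤ 1 := by rw [sq_le_one_iff_abs_le_one]; exact h1 x
    change 0 ≤ t ^ 2 - 2 * t * (f x * g x) + g x * g x
    nlinarith [sq_nonneg (g x - t * f x), mul_nonneg (sq_nonneg t) (sub_nonneg.2 this)]
  have i3 : Integrable (fun x => t ^ 2 - 2 * t * (f x * g x)) γ :=
    (integrable_const _).sub (i2.const_mul _)
  rw [integral_add i3 i1, integral_sub (integrable_const _) (i2.const_mul _),
    integral_const_mul] at h0
  simp only [integral_const, probReal_univ, one_smul] at h0
  linarith

/-- A function on `(0,1)` with `φ(ρ)² ≤ φ(ρ²)` and `φ(ρ) = O(ρ^m)` at `0` satisfies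
`φ(ρ) ≤ ρ^m`. -/
theorem le_pow_of_sq_le {φ : ℝ → ℝ} {m : ℕ} {C ρ₀ : ℝ} (hρ₀ : 0 < ρ₀)
    (hsq : ∀ ρ, 0 < ρ → ρ < 1 → φ ρ ^ 2 ≤ φ (ρ ^ 2))
    (hC : ∀ ρ, 0 < ρ → ρ ≤ ρ₀ → ρ < 1 → φ ρ ≤ C * ρ ^ m) {ρ : ℝ} (h0 : 0 < ρ) (h1 : ρ < 1) :
    φ ρ ≤ ρ ^ m := by
  by_contra! h
  have hm : 0 < ρ ^ m := pow_pos h0 m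
  have hφ : 0 < φ ρ := hm.trans h
  -- Repeated squaring gives `φ(ρ)^(2^n) ≤ φ(ρ^(2^n)) ≤ C (ρ^m)^(2^n)` for large `n`. A ratio `φ(ρ)
  -- / ρ^m > 1` would have powers exceeding `C`.
  have hit : ∀ n : ℕ, φ ρ ^ (2 ^ n) ≤ φ (ρ ^ (2 ^ n)) := by
    intro n
    induction n with
    | zero => simp
    | succ n ih =>
      rw [pow_succ 2 n, pow_mul, pow_mul]
      exact (pow_le_pow_left₀ (by positivity) ih 2).trans
        (hsq _ (by positivity) (pow_lt_one₀ h0.le h1 (by positivity)))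
  have hq : 1 < φ ρ / ρ ^ m := (one_lt_div hm).2 h
  obtain ⟨n₁, hn₁⟩ := exists_pow_lt_of_lt_one hρ₀ h1
  obtain ⟨n₂, hn₂⟩ := pow_unbounded_of_one_lt C hq
  set n := max n₁ n₂
  have hn : n ≤ 2 ^ n := Nat.lt_two_pow_self.le
  have ha : ρ ^ (2 ^ n) ≤ ρ₀ :=
    (pow_le_pow_of_le_one h0.le h1.le ((le_max_left n₁ n₂).trans hn)).trans hn₁.le
  have hb := (hit n).trans (hC _ (by positivity) ha (pow_lt_one₀ h0.le h1 (by positivity)))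
  have hc : C < (φ ρ / ρ ^ m) ^ (2 ^ n) :=
    hn₂.trans_le (pow_le_pow_right₀ hq.le ((le_max_right n₁ n₂).trans hn))
  rw [div_pow, lt_div_iff₀ (by positivity), ← pow_mul, mul_comm m, pow_mul] at hc
  exact absurd hb (not_le.2 hc)

end Correlation

/-! ### Correlated Gaussian pairs and the Mehler kernel. -/

section Gaussian

/-- The law of a pair of standard Gaussian variables with correlation `ρ`. -/
noncomputable def gaussianPair (ρ : ℝ) : Measure (ℝ × ℝ) :=
  ((gaussianReal 0 1).prod (gaussianReal 0 1)).map
    fun z => (z.1, ρ * z.1 + √(1 - ρ ^ 2) * z.2)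

theorem gaussianReal_prod_map_add (a b : ℝ) (v w : NNReal) :
    ((gaussianReal 0 v).prod (gaussianReal 0 w)).map (fun z => a * z.1 + b * z.2) =
      gaussianReal 0 (.mk (a ^ 2) (sq_nonneg a) * v + .mk (b ^ 2) (sq_nonneg b) * w) := by
  have h := gaussianReal_conv_gaussianReal (m₁ := a * 0) (m₂ := b * 0)
    (v₁ := .mk (a ^ 2) (sq_nonneg a) * v) (v₂ := .mk (b ^ 2) (sq_nonneg b) * w)
  rw [← gaussianReal_map_const_mul, ← gaussianReal_map_const_mul, Measure.conv,
    Measure.map_prod_map _ _ (by fun_prop) (by fun_prop),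
    Measure.map_map (by fun_prop) (by fun_prop)] at h
  simpa [Function.comp_def] using h

theorem gaussianReal_prod_prod_map_add (a b c : ℝ) :
    ((gaussianReal 0 1).prod ((gaussianReal 0 1).prod (gaussianReal 0 1))).map
      (fun z => a * z.1 + (b * z.2.1 + c * z.2.2)) =
      gaussianReal 0 (.mk (a ^ 2) (sq_nonneg a) + .mk (b ^ 2) (sq_nonneg b) + .mk (c ^ 2) (sq_nonneg c)) := by
  have h := gaussianReal_prod_map_add a 1 1 (.mk (b ^ 2) (sq_nonneg b) * 1 + .mk (c ^ 2) (sq_nonneg c) * 1)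
  rw [← gaussianReal_prod_map_add b c 1 1] at h
  nth_rw 1 [← Measure.map_id (μ := gaussianReal 0 1)] at h
  rw [Measure.map_prod_map _ _ (by fun_prop) (by fun_prop),
    Measure.map_map (by fun_prop) (by fun_prop)] at h
  convert h using 2
  · ext z; simp
  · simp [add_assoc]

/-- Measures on the plane are determined by their one-dimensional marginals. -/
theorem ext_of_map_linear {m m' : Measure (ℝ × ℝ)} [IsProbabilityMeasure m]
    [IsProbabilityMeasure m']
    (h : ∀ s t : ℝ, m.map (fun z => s * z.1 + t * z.2) = m'.map (fun z => s * z.1 + t * z.2)) :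
    m = m' := by
  refine Measure.ext_of_charFunDual (funext fun L => ?_)
  have hL : (L : ℝ × ℝ → ℝ) = fun z => L (1, 0) * z.1 + L (0, 1) * z.2 := by
    ext z
    have : z = z.1 • ((1 : ℝ), (0 : ℝ)) + z.2 • ((0 : ℝ), (1 : ℝ)) := by ext <;> simp
    conv_lhs => rw [this, map_add, map_smul, map_smul]
    simp [mul_comm]
  rw [charFunDual_eq_charFun_map_one, charFunDual_eq_charFun_map_one, hL, h]

instance (ρ : ℝ) : IsProbabilityMeasure (gaussianPair ρ) :=
  Measure.isProbabilityMeasure_map (by fun_prop)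

/-- Both coordinates are noisy copies of a common variable with independent noises. Linear forms on
either side are centred Gaussian, so comparing variances suffices. -/
theorem gaussianPair_semigroup {ρ : ℝ} (h0 : 0 ≤ ρ) (h1 : ρ ≤ 1) :
    ((gaussianReal 0 1).prod ((gaussianReal 0 1).prod (gaussianReal 0 1))).map
      (fun z => (ρ * z.1 + √(1 - ρ ^ 2) * z.2.1, ρ * z.1 + √(1 - ρ ^ 2) * z.2.2)) =
      gaussianPair (ρ ^ 2) := by
  have h2 : ρ ^ 2 ≤ 1 := pow_le_one₀ h0 h1
  have h4 : (ρ ^ 2) ^ 2 ≤ 1 := pow_le_one₀ (sq_nonneg ρ) h2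
  have := Measure.isProbabilityMeasure_map
    (μ := (gaussianReal 0 1).prod ((gaussianReal 0 1).prod (gaussianReal 0 1)))
    (f := fun z : ℝ × ℝ × ℝ => (ρ * z.1 + √(1 - ρ ^ 2) * z.2.1, ρ * z.1 + √(1 - ρ ^ 2) * z.2.2))
    (by fun_prop)
  refine ext_of_map_linear fun s t => ?_
  rw [gaussianPair, Measure.map_map (by fun_prop) (by fun_prop),
    Measure.map_map (by fun_prop) (by fun_prop)]
  have e1 : ((fun z : ℝ × ℝ => s * z.1 + t * z.2) ∘ fun z : ℝ × ℝ × ℝ =>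
      (ρ * z.1 + √(1 - ρ ^ 2) * z.2.1, ρ * z.1 + √(1 - ρ ^ 2) * z.2.2)) = fun z =>
      ((s + t) * ρ) * z.1 + ((s * √(1 - ρ ^ 2)) * z.2.1 + (t * √(1 - ρ ^ 2)) * z.2.2) := by
    ext z; simp only [Function.comp]; ring
  have e2 : ((fun z : ℝ × ℝ => s * z.1 + t * z.2) ∘ fun z : ℝ × ℝ =>
      (z.1, ρ ^ 2 * z.1 + √(1 - (ρ ^ 2) ^ 2) * z.2)) = fun z =>
      (s + t * ρ ^ 2) * z.1 + (t * √(1 - (ρ ^ 2) ^ 2)) * z.2 := by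
    ext z; simp only [Function.comp]; ring
  rw [e1, e2, gaussianReal_prod_prod_map_add, gaussianReal_prod_map_add]
  congr 1
  ext
  simp only [mul_one, NNReal.coe_add, NNReal.coe_mk, mul_pow,
    Real.sq_sqrt (sub_nonneg.2 h2), Real.sq_sqrt (sub_nonneg.2 h4)]
  ring

theorem gaussianPair_map_fst (ρ : ℝ) : (gaussianPair ρ).map Prod.fst = gaussianReal 0 1 := by
  rw [gaussianPair, Measure.map_map (by fun_prop) (by fun_prop)]
  exact Measure.map_fst_prod.trans (by simp)

theorem gaussianPair_map_snd {ρ : ℝ} (h0 : 0 ≤ ρ) (h1 : ρ ≤ 1) :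
    (gaussianPair ρ).map Prod.snd = gaussianReal 0 1 := by
  have h2 : ρ ^ 2 ≤ 1 := pow_le_one₀ h0 h1
  rw [gaussianPair, Measure.map_map (by fun_prop) (by fun_prop)]
  refine (gaussianReal_prod_map_add ρ (√(1 - ρ ^ 2)) 1 1).trans ?_
  congr 1
  rw [← NNReal.coe_inj]
  simp [Real.sq_sqrt (sub_nonneg.2 h2)]

/-- The density of `gaussianPair ρ` relative to independent standard Gaussian variables. -/
noncomputable def mehlerKernel (ρ : ℝ) (z : ℝ × ℝ) : ℝ :=
  (√(1 - ρ ^ 2))⁻¹ *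
    Real.exp ((2 * ρ * z.1 * z.2 - ρ ^ 2 * (z.1 ^ 2 + z.2 ^ 2)) / (2 * (1 - ρ ^ 2)))

theorem mehlerKernel_nonneg (ρ : ℝ) (z : ℝ × ℝ) : 0 ≤ mehlerKernel ρ z := by
  unfold mehlerKernel; positivity

@[fun_prop]
theorem measurable_mehlerKernel (ρ : ℝ) : Measurable (mehlerKernel ρ) := by
  unfold mehlerKernel; fun_prop

/-- Completing the square: the right side is the conditional density of the second coordinate given
that the first is `x`. -/
theorem mehlerKernel_mul_gaussianPDFReal {ρ : ℝ} (h : ρ ^ 2 < 1) (x y : ℝ) :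
    gaussianPDFReal 0 1 y * mehlerKernel ρ (x, y) =
      gaussianPDFReal (ρ * x) (.mk (1 - ρ ^ 2) (sub_pos.2 h).le) y := by
  have hp : 0 < 1 - ρ ^ 2 := sub_pos.2 h
  have hp' := hp.ne'
  simp only [gaussianPDFReal, mehlerKernel, NNReal.coe_one, NNReal.coe_mk, mul_one, sub_zero]
  rw [Real.sqrt_mul (x := 2 * Real.pi) (by positivity) (1 - ρ ^ 2), mul_inv, mul_mul_mul_comm,
    ← Real.exp_add]
  congr 2
  field_simp
  ring

theorem gaussianPair_eq_withDensity {ρ : ℝ} (h : ρ ^ 2 < 1) :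
    gaussianPair ρ = ((gaussianReal 0 1).prod (gaussianReal 0 1)).withDensity
      fun z => ENNReal.ofReal (mehlerKernel ρ z) := by
  have hp : 0 < 1 - ρ ^ 2 := sub_pos.2 h
  refine Measure.ext_of_lintegral _ fun F hF => ?_
  have hK : Measurable fun z => ENNReal.ofReal (mehlerKernel ρ z) := by fun_prop
  rw [lintegral_withDensity_eq_lintegral_mul _ hK hF, gaussianPair,
    lintegral_map hF (by fun_prop), lintegral_prod _ (by fun_prop),
    lintegral_prod _ (by fun_prop)]
  refine lintegral_congr fun x => ?_
  have hv : NNReal.mk (1 - ρ ^ 2) hp.le ≠ 0 := fun h => hp.ne' (congrArg NNReal.toReal h)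
  have e1 : (gaussianReal 0 1).map (fun y => ρ * x + √(1 - ρ ^ 2) * y) =
      gaussianReal (ρ * x) (.mk (1 - ρ ^ 2) hp.le) := by
    have h1 : (fun y => ρ * x + √(1 - ρ ^ 2) * y) =
        (fun y => ρ * x + y) ∘ fun y => √(1 - ρ ^ 2) * y := rfl
    rw [h1, ← Measure.map_map (by fun_prop) (by fun_prop), gaussianReal_map_const_mul,
      gaussianReal_map_const_add]
    congr 1
    · ring
    · ext; simp [Real.sq_sqrt hp.le]
  have e2 : ∫⁻ y, F (x, ρ * x + √(1 - ρ ^ 2) * y) ∂gaussianReal 0 1 =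
      ∫⁻ y, F (x, y) ∂gaussianReal (ρ * x) (.mk (1 - ρ ^ 2) hp.le) := by
    rw [← e1, lintegral_map (f := fun y => F (x, y)) (by fun_prop) (by fun_prop)]
  rw [e2, gaussianReal_of_var_ne_zero _ hv, gaussianReal_of_var_ne_zero _ one_ne_zero,
    lintegral_withDensity_eq_lintegral_mul _ (measurable_gaussianPDF _ _) (by fun_prop),
    lintegral_withDensity_eq_lintegral_mul _ (measurable_gaussianPDF _ _) (by fun_prop)]
  refine lintegral_congr fun y => ?_
  simp only [Pi.mul_apply, gaussianPDF]
  rw [← mehlerKernel_mul_gaussianPDFReal h, ENNReal.ofReal_mul (gaussianPDFReal_nonneg _ _ _),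
    mul_assoc]

theorem abs_exp_sub_one_le_mul_exp (a : ℝ) : |Real.exp a - 1| ≤ |a| * Real.exp |a| := by
  rcases le_total 0 a with h | h
  · rw [abs_of_nonneg h, abs_of_nonneg (sub_nonneg.2 (Real.one_le_exp h))]
    have := Real.add_one_le_exp (-a)
    have h2 : Real.exp a * Real.exp (-a) = 1 := by rw [← Real.exp_add]; simp
    nlinarith [Real.exp_pos a]
  · rw [abs_of_nonpos h, abs_of_nonpos (sub_nonpos.2 (Real.exp_le_one_iff.2 h))]
    have := Real.add_one_le_exp a
    nlinarith [Real.one_le_exp (neg_nonneg.2 h)]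

/-- The factor `ρ` is what each coordinate contributes to the decay; the weight grows slowly enough
to be Gaussian integrable. With `t = x² + y²`, the exponent is at most `ρ t ≤ t / 8` in absolute
value, `t ≤ 8 exp (t / 8)`, and the prefactor lies between `1` and `1 + ρ ≤ 2`. Hence `17 = 2 * 8 +
1`. -/
theorem abs_mehlerKernel_sub_one_le {ρ : ℝ} (h0 : 0 ≤ ρ) (h1 : ρ ≤ 1 / 8) (z : ℝ × ℝ) :
    |mehlerKernel ρ z - 1| ≤
      ρ * (17 * (Real.exp (4⁻¹ * z.1 ^ 2) * Real.exp (4⁻¹ * z.2 ^ 2))) := by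
  obtain ⟨x, y⟩ := z
  simp only [mehlerKernel]
  set t := x ^ 2 + y ^ 2 with ht
  have ht0 : 0 ≤ t := by positivity
  set a := (2 * ρ * x * y - ρ ^ 2 * t) / (2 * (1 - ρ ^ 2)) with ha
  have hd : 15 / 8 ≤ 2 * (1 - ρ ^ 2) := by nlinarith
  have ha1 : |a| ≤ ρ * t := by
    rw [ha, abs_div, abs_of_pos (by linarith : 0 < 2 * (1 - ρ ^ 2)), div_le_iff₀ (by linarith),
      abs_le]
    have hxy : 2 * x * y ≤ t := by nlinarith [sq_nonneg (x - y)]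
    have hxy' : -t ≤ 2 * x * y := by nlinarith [sq_nonneg (x + y)]
    have hρt : 0 ≤ ρ * t := by positivity
    constructor
    · nlinarith [mul_le_mul_of_nonneg_left hxy' h0, mul_nonneg h0 hρt]
    · nlinarith [mul_le_mul_of_nonneg_left hxy h0, mul_nonneg h0 hρt]
  have hw : Real.exp (4⁻¹ * x ^ 2) * Real.exp (4⁻¹ * y ^ 2) =
      Real.exp (t / 8) * Real.exp (t / 8) := by
    rw [← Real.exp_add, ← Real.exp_add, ht]; ring_nf
  have he : |Real.exp a - 1| ≤ ρ * (8 * (Real.exp (t / 8) * Real.exp (t / 8))) := by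
    calc |Real.exp a - 1| ≤ |a| * Real.exp |a| := abs_exp_sub_one_le_mul_exp a
      _ ≤ (ρ * t) * Real.exp (t / 8) := by
        gcongr
        exact ha1.trans (by nlinarith)
      _ ≤ (ρ * (8 * Real.exp (t / 8))) * Real.exp (t / 8) := by
        gcongr
        linarith [Real.add_one_le_exp (t / 8)]
      _ = _ := by ring
  have hs : 0 < √(1 - ρ ^ 2) := Real.sqrt_pos.2 (by linarith)
  have hc1 : 1 ≤ (√(1 - ρ ^ 2))⁻¹ :=
    one_le_inv_iff₀.2 ⟨hs, Real.sqrt_le_one.2 (by nlinarith)⟩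
  have hc2 : (√(1 - ρ ^ 2))⁻¹ ≤ 1 + ρ := by
    rw [inv_le_comm₀ hs (by linarith), ← one_div]
    refine Real.le_sqrt_of_sq_le ?_
    rw [div_pow, one_pow, div_le_iff₀ (by positivity)]
    have : ρ ^ 3 ≤ ρ := pow_le_of_le_one h0 (by linarith) (by norm_num)
    have : ρ ^ 4 ≤ ρ := pow_le_of_le_one h0 (by linarith) (by norm_num)
    nlinarith [mul_nonneg h0 (sq_nonneg ρ), mul_nonneg h0 h0]
  set c := (√(1 - ρ ^ 2))⁻¹
  have h3 : 1 ≤ Real.exp (t / 8) * Real.exp (t / 8) := by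
    rw [← Real.exp_add]; exact Real.one_le_exp (by linarith)
  rw [hw]
  calc |c * Real.exp a - 1| = |c * (Real.exp a - 1) + (c - 1)| := by ring_nf
    _ ≤ |c * (Real.exp a - 1)| + |c - 1| := abs_add_le _ _
    _ = c * |Real.exp a - 1| + (c - 1) := by
      rw [abs_mul, abs_of_pos (by linarith : 0 < c), abs_of_nonneg (by linarith : 0 ≤ c - 1)]
    _ ≤ 2 * (ρ * (8 * (Real.exp (t / 8) * Real.exp (t / 8)))) +
        ρ * (Real.exp (t / 8) * Real.exp (t / 8)) := by
      gcongr
      · linarith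
      · nlinarith
    _ = _ := by ring

theorem integrable_exp_sq_gaussianReal :
    Integrable (fun x => Real.exp (4⁻¹ * x ^ 2)) (gaussianReal 0 1) := by
  rw [gaussianReal_of_var_ne_zero _ one_ne_zero]
  unfold gaussianPDF
  rw [integrable_withDensity_iff_integrable_smul₀' (by fun_prop) (by simp)]
  have := (integrable_exp_neg_mul_sq (b := 4⁻¹) (by norm_num)).const_mul (√(2 * Real.pi))⁻¹
  refine this.congr (ae_of_all _ fun x => ?_)
  beta_reduce
  rw [ENNReal.toReal_ofReal (gaussianPDFReal_nonneg _ _ _), gaussianPDFReal, smul_eq_mul,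
    mul_assoc, ← Real.exp_add]
  simp only [NNReal.coe_one, mul_one, sub_zero]
  ring_nf

end Gaussian

/-! ### Decay of Gaussian correlations. -/

section Decay

variable {E : Type*} [Fintype E]

/-- For every set `S` of fewer than `m` coordinates there are sign changes of coordinates outside
`S` which turn `f` into `-f`. -/
def FlipsOffSmallSets (f : (E → ℝ) → ℝ) (m : ℕ) : Prop :=
  ∀ S : Finset E, S.card < m → ∃ ε : E → ℝ, (∀ e, ε e = 1 ∨ ε e = -1) ∧ (∀ e ∈ S, ε e = 1) ∧
    ∀ x, f (fun e => ε e * x e) = -f x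

theorem measurePreserving_gaussianReal_sign {c : ℝ} (hc : c = 1 ∨ c = -1) :
    MeasurePreserving (fun x => c * x) (gaussianReal 0 1) (gaussianReal 0 1) := by
  refine ⟨by fun_prop, ?_⟩
  rw [gaussianReal_map_const_mul]
  congr 1
  · simp
  · rw [← NNReal.coe_inj]
    rcases hc with rfl | rfl <;> simp

theorem integral_eq_zero_of_comp_eq_neg {Ω : Type*} [MeasurableSpace Ω] {P : Measure Ω}
    {T : Ω → Ω} (hT : MeasurePreserving T P P) {g : Ω → ℝ} (hg : AEStronglyMeasurable g P)
    (h : ∀ x, g (T x) = -g x) : ∫ x, g x ∂P = 0 := by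
  have h1 : ∫ x, g x ∂P = ∫ x, g (T x) ∂P := by
    conv_lhs => rw [← hT.map_eq]
    rw [integral_map hT.measurable.aemeasurable (by rwa [hT.map_eq])]
  simp_rw [h, integral_neg] at h1
  linarith

/-- The density `∏ K(w e)` is expanded as `∑ S, ∏ e ∈ S, (K(w e) - 1)`. Terms with fewer than `m`
factors vanish by the sign flip; in the others each factor is `O(ρ)` with an integrable weight
independent of `ρ`. -/
theorem corr_gaussianPair_le {f : (E → ℝ) → ℝ} (hf : Measurable f) (h1 : ∀ x, |f x| ≤ 1) {m : ℕ}
    (hm : FlipsOffSmallSets f m) :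
    ∃ C : ℝ, ∀ ρ, 0 ≤ ρ → ρ ≤ 1 / 8 → corr f (gaussianPair ρ) ≤ C * ρ ^ m := by
  classical
  set γ := gaussianReal 0 1 with hγ
  set Q := Measure.pi fun _ : E => γ.prod γ with hQ
  set h : ℝ × ℝ → ℝ := fun z => 17 * (Real.exp (4⁻¹ * z.1 ^ 2) * Real.exp (4⁻¹ * z.2 ^ 2))
  have h0 : ∀ z, 0 ≤ h z := fun z => by positivity
  have hi : Integrable h (γ.prod γ) :=
    (integrable_exp_sq_gaussianReal.mul_prod integrable_exp_sq_gaussianReal).const_mul 17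
  have hS : ∀ (u : ℝ × ℝ → ℝ), Integrable u (γ.prod γ) → ∀ S : Finset E,
      Integrable (fun w : E → ℝ × ℝ => ∏ e ∈ S, u (w e)) Q := fun u hu S => by
    have := Integrable.fintype_prod (μ := fun _ : E => γ.prod γ)
      (f := fun e z => if e ∈ S then u z else 1) (fun e => by
        by_cases he : e ∈ S <;> simp [he, hu])
    refine this.congr (ae_of_all _ fun w => ?_)
    simp [Finset.prod_ite_mem]
  refine ⟨∑ S : Finset E, ∫ w, ∏ e ∈ S, h (w e) ∂Q, fun ρ hρ0 hρ1 => ?_⟩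
  have hsq : ρ ^ 2 < 1 := by nlinarith
  have hd : ∀ z, |mehlerKernel ρ z - 1| ≤ ρ * h z := abs_mehlerKernel_sub_one_le hρ0 hρ1
  have hKi' : Integrable (fun z => mehlerKernel ρ z - 1) (γ.prod γ) :=
    Integrable.mono' (hi.const_mul ρ) (by fun_prop) (ae_of_all _ hd)
  have hKi : Integrable (mehlerKernel ρ) (γ.prod γ) := by
    refine (hKi'.add (integrable_const (1 : ℝ))).congr (ae_of_all _ fun z => ?_)
    simp
  set ff : (E → ℝ × ℝ) → ℝ := fun w => f (fun e => (w e).1) * f (fun e => (w e).2) with hff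
  have hffm : Measurable ff := by fun_prop
  have hff1 : ∀ w, |ff w| ≤ 1 := fun w => abs_mul_le_one (h1 _) (h1 _)
  have hcorr : corr f (gaussianPair ρ) =
      ∑ S : Finset E, ∫ w, (∏ e ∈ S, (mehlerKernel ρ (w e) - 1)) * ff w ∂Q := by
    rw [corr, gaussianPair_eq_withDensity hsq,
      pi_withDensity_ofReal _ hKi (mehlerKernel_nonneg ρ),
      integral_withDensity_eq_integral_toReal_smul (by fun_prop) (by simp), ← integral_finsetSum]
    · refine integral_congr_ae (ae_of_all _ fun w => ?_)
      beta_reduce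
      rw [ENNReal.toReal_ofReal (Finset.prod_nonneg fun e _ => mehlerKernel_nonneg ρ _),
        ← Finset.sum_mul, smul_eq_mul, ← Finset.powerset_univ, ← Finset.prod_one_add]
      simp [ff]
    · exact fun S _ => (hS _ hKi' S).mul_bdd (c := 1) hffm.aestronglyMeasurable
        (ae_of_all _ hff1)
  rw [hcorr, Finset.sum_mul]
  refine Finset.sum_le_sum fun S _ => ?_
  have hpos : 0 ≤ ∫ w, ∏ e ∈ S, h (w e) ∂Q :=
    integral_nonneg fun w => Finset.prod_nonneg fun e _ => h0 _
  rcases lt_or_ge S.card m with hlt | hge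
  · obtain ⟨ε, hε, hεS, hflip⟩ := hm S hlt
    -- The flip acts on the first family only: it negates `f(X)`, leaves `f(Y)` alone, and fixes the
    -- factors indexed by `S`, where `ε = 1`.
    have hT : MeasurePreserving
        (fun (w : E → ℝ × ℝ) e => Prod.map (fun x => ε e * x) id (w e)) Q Q :=
      measurePreserving_pi _ _ fun e =>
        (measurePreserving_gaussianReal_sign (hε e)).prod (MeasurePreserving.id γ)
    rw [integral_eq_zero_of_comp_eq_neg hT (by fun_prop)]
    · positivity
    · intro w
      have e1 : ∏ e ∈ S, (mehlerKernel ρ (Prod.map (fun x => ε e * x) id (w e)) - 1) =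
          ∏ e ∈ S, (mehlerKernel ρ (w e) - 1) :=
        Finset.prod_congr rfl fun e he => by simp [hεS e he, Prod.map]
      have e2 := hflip fun e => (w e).1
      rw [e1]
      simp only [ff, Prod.map_fst, Prod.map_snd, id, e2]
      ring
  · rw [← integral_mul_const]
    refine integral_mono ((hS _ hKi' S).mul_bdd (c := 1) hffm.aestronglyMeasurable
      (ae_of_all _ hff1)) ((hS h hi S).mul_const _) fun w => ?_
    have h3 : 0 ≤ ∏ e ∈ S, h (w e) := Finset.prod_nonneg fun e _ => h0 _
    calc (∏ e ∈ S, (mehlerKernel ρ (w e) - 1)) * ff w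
        ≤ |(∏ e ∈ S, (mehlerKernel ρ (w e) - 1)) * ff w| := le_abs_self _
      _ ≤ |∏ e ∈ S, (mehlerKernel ρ (w e) - 1)| := by
        rw [abs_mul]; exact mul_le_of_le_one_right (abs_nonneg _) (hff1 w)
      _ ≤ ∏ e ∈ S, ρ * h (w e) := by
        rw [Finset.abs_prod]
        exact Finset.prod_le_prod (fun e _ => abs_nonneg _) fun e _ => hd _
      _ = (∏ e ∈ S, h (w e)) * ρ ^ S.card := by
        rw [Finset.prod_mul_distrib, Finset.prod_const, mul_comm]
      _ ≤ (∏ e ∈ S, h (w e)) * ρ ^ m :=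
        mul_le_mul_of_nonneg_left (pow_le_pow_of_le_one hρ0 (by linarith) hge) h3

theorem corr_gaussianPair_le_pow {f : (E → ℝ) → ℝ} (hf : Measurable f) (h1 : ∀ x, |f x| ≤ 1)
    {m : ℕ} (hm : FlipsOffSmallSets f m) {ρ : ℝ} (hρ0 : 0 < ρ) (hρ1 : ρ < 1) :
    corr f (gaussianPair ρ) ≤ ρ ^ m := by
  obtain ⟨C, hC⟩ := corr_gaussianPair_le hf h1 hm
  refine le_pow_of_sq_le (φ := fun ρ => corr f (gaussianPair ρ)) (ρ₀ := 1 / 8) (by norm_num)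
    (fun ρ h0 h1' => ?_) (fun ρ h0 h8 _ => hC ρ h0.le h8) hρ0 hρ1
  have := corr_sq_le (gaussianReal 0 1) (gaussianReal 0 1)
    (k := fun z => ρ * z.1 + √(1 - ρ ^ 2) * z.2) (by fun_prop) hf h1
  rwa [gaussianPair_semigroup h0.le h1'.le] at this

end Decay

/-! ### The resampling perturbation and its correlations. -/

section Resampling

/-- The law of a pair `(X, Y)` with `X` standard Gaussian and `Y` equal to `X` with probability
`ρ`, an independent copy of `X` otherwise. -/
noncomputable def resamplePair (ρ : ℝ) : Measure (ℝ × ℝ) :=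
  ENNReal.ofReal ρ • (gaussianReal 0 1).map (fun x => (x, x)) +
    ENNReal.ofReal (1 - ρ) • (gaussianReal 0 1).prod (gaussianReal 0 1)

/-- The law of a pair of a resampled value and a resampling indicator. -/
noncomputable abbrev resampleSource (p : unitInterval) : Measure (ℝ × Bool) :=
  (gaussianReal 0 1).prod (bernoulliMeasure true false p)

/-- The value after resampling. -/
def resample (z : ℝ × ℝ × Bool) : ℝ := if z.2.2 = true then z.2.1 else z.1

@[fun_prop]
theorem measurable_resample : Measurable resample :=
  Measurable.ite (measurableSet_eq_fun (by fun_prop) (by fun_prop)) (by fun_prop) (by fun_prop)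

theorem lintegral_bernoulliMeasure_bool (p : unitInterval) (F : Bool → ENNReal) :
    ∫⁻ b, F b ∂bernoulliMeasure true false p =
      ENNReal.ofReal p * F true + ENNReal.ofReal (1 - p) * F false := by
  rw [bernoulliMeasure_def, lintegral_add_measure, lintegral_smul_measure, lintegral_smul_measure,
    lintegral_dirac, lintegral_dirac]
  have e1 : ENNReal.ofReal p = (unitInterval.toNNReal p : ENNReal) := by
    rw [ENNReal.ofReal, Real.toNNReal_of_nonneg p.2.1]; rfl
  have e2 : ENNReal.ofReal (1 - p) = (unitInterval.toNNReal (unitInterval.symm p) : ENNReal) := by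
    rw [ENNReal.ofReal, Real.toNNReal_of_nonneg (sub_nonneg.2 p.2.2)]; rfl
  rw [e1, e2]
  rfl

theorem lintegral_resampleSource (p : unitInterval) {F : ℝ × Bool → ENNReal} (hF : Measurable F) :
    ∫⁻ u, F u ∂resampleSource p =
      ENNReal.ofReal p * ∫⁻ y, F (y, true) ∂gaussianReal 0 1 +
        ENNReal.ofReal (1 - p) * ∫⁻ y, F (y, false) ∂gaussianReal 0 1 := by
  rw [lintegral_prod _ hF.aemeasurable]
  simp_rw [lintegral_bernoulliMeasure_bool]
  rw [lintegral_add_left (by fun_prop), lintegral_const_mul _ (by fun_prop),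
    lintegral_const_mul _ (by fun_prop)]

theorem lintegral_resamplePair (ρ : ℝ) {F : ℝ × ℝ → ENNReal} (hF : Measurable F) :
    ∫⁻ z, F z ∂resamplePair ρ = ENNReal.ofReal ρ * ∫⁻ x, F (x, x) ∂gaussianReal 0 1 +
      ENNReal.ofReal (1 - ρ) * ∫⁻ x, ∫⁻ y, F (x, y) ∂gaussianReal 0 1 ∂gaussianReal 0 1 := by
  rw [resamplePair, lintegral_add_measure, lintegral_smul_measure, lintegral_smul_measure,
    lintegral_map hF (by fun_prop), lintegral_prod _ hF.aemeasurable]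
  rfl

theorem map_resample_eq_resamplePair (p : unitInterval) :
    ((gaussianReal 0 1).prod (resampleSource p)).map (fun z => (z.1, resample z)) =
      resamplePair (1 - p) := by
  refine Measure.ext_of_lintegral _ fun F hF => ?_
  rw [lintegral_resamplePair _ hF, lintegral_map hF (by fun_prop),
    lintegral_prod _ (by fun_prop)]
  have h : ∀ x : ℝ, ∫⁻ u, F (x, resample (x, u)) ∂resampleSource p =
      ENNReal.ofReal p * ∫⁻ y, F (x, y) ∂gaussianReal 0 1 + ENNReal.ofReal (1 - p) * F (x, x) :=
    fun x => by
      rw [lintegral_resampleSource p (by fun_prop)]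
      simp [resample]
  simp_rw [h]
  rw [lintegral_add_left (by fun_prop), lintegral_const_mul _ (by fun_prop),
    lintegral_const_mul _ (by fun_prop), sub_sub_cancel, add_comm]

/-- Both copies keep the common value with probability `(1 - p)²`; in the three other cases they are
independent standard Gaussians. -/
theorem resamplePair_semigroup (p : unitInterval) :
    ((gaussianReal 0 1).prod ((resampleSource p).prod (resampleSource p))).map
      (fun z => (resample (z.1, z.2.1), resample (z.1, z.2.2))) =
      resamplePair ((1 - p) ^ 2) := by
  refine Measure.ext_of_lintegral _ fun F hF => ?_
  rw [lintegral_resamplePair _ hF, lintegral_map hF (by fun_prop),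
    lintegral_prod _ (by fun_prop)]
  set γ := gaussianReal 0 1 with hγ
  have h : ∀ x : ℝ, ∫⁻ u, F (resample (x, u.1), resample (x, u.2))
      ∂(resampleSource p).prod (resampleSource p) =
      ENNReal.ofReal p * (ENNReal.ofReal p * ∫⁻ y, ∫⁻ y', F (y, y') ∂γ ∂γ +
        ENNReal.ofReal (1 - p) * ∫⁻ y, F (y, x) ∂γ) +
      ENNReal.ofReal (1 - p) * (ENNReal.ofReal p * ∫⁻ y', F (x, y') ∂γ +
        ENNReal.ofReal (1 - p) * F (x, x)) := fun x => by
    rw [lintegral_prod _ (by fun_prop), lintegral_resampleSource p (by fun_prop)]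
    have h2 : ∀ y : ℝ, ∫⁻ u, F (y, resample (x, u)) ∂resampleSource p =
        ENNReal.ofReal p * ∫⁻ y', F (y, y') ∂γ + ENNReal.ofReal (1 - p) * F (y, x) := fun y => by
      rw [lintegral_resampleSource p (by fun_prop)]
      simp [resample, hγ]
    have h3 : ∀ y, resample (x, y, true) = y := fun y => by simp [resample]
    have h4 : ∀ y, resample (x, y, false) = x := fun y => by simp [resample]
    simp_rw [h3, h4, h2]
    rw [lintegral_add_left (by fun_prop), lintegral_const_mul _ (by fun_prop),
      lintegral_const_mul _ (by fun_prop), lintegral_const, measure_univ, mul_one]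
  simp_rw [h]
  have hsw : ∫⁻ x, ∫⁻ y, F (y, x) ∂γ ∂γ = ∫⁻ x, ∫⁻ y, F (x, y) ∂γ ∂γ :=
    (lintegral_lintegral_swap (by fun_prop))
  rw [lintegral_add_left (by fun_prop), lintegral_const_mul _ (by fun_prop),
    lintegral_const_mul _ (by fun_prop), lintegral_add_left (by fun_prop),
    lintegral_add_left (by fun_prop), lintegral_const_mul _ (by fun_prop),
    lintegral_const_mul _ (by fun_prop), lintegral_const_mul _ (by fun_prop), lintegral_const,
    lintegral_const_mul _ (by fun_prop), measure_univ, mul_one, hsw]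
  have e1 : ENNReal.ofReal ((1 - p) ^ 2) = ENNReal.ofReal (1 - p) * ENNReal.ofReal (1 - p) := by
    rw [sq, ENNReal.ofReal_mul (sub_nonneg.2 p.2.2)]
  have e2 : ENNReal.ofReal (1 - (1 - p) ^ 2) = ENNReal.ofReal p * ENNReal.ofReal p +
      ENNReal.ofReal p * ENNReal.ofReal (1 - p) + ENNReal.ofReal (1 - p) * ENNReal.ofReal p := by
    have h0 := p.2.1
    have h1 : 0 ≤ 1 - (p : ℝ) := sub_nonneg.2 p.2.2
    rw [← ENNReal.ofReal_mul h0, ← ENNReal.ofReal_mul h0, ← ENNReal.ofReal_mul h1,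
      ← ENNReal.ofReal_add (by positivity) (by positivity),
      ← ENNReal.ofReal_add (by positivity) (by positivity)]
    congr 1
    ring
  rw [e1, e2]
  ring

theorem isProbabilityMeasure_resamplePair (p : unitInterval) :
    IsProbabilityMeasure (resamplePair (1 - p)) := by
  rw [← map_resample_eq_resamplePair]
  exact Measure.isProbabilityMeasure_map (by fun_prop)

theorem resamplePair_map_fst (p : unitInterval) :
    (resamplePair (1 - p)).map Prod.fst = gaussianReal 0 1 := by
  rw [← map_resample_eq_resamplePair, Measure.map_map (by fun_prop) (by fun_prop)]
  exact Measure.map_fst_prod.trans (by simp)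

theorem resamplePair_map_snd (p : unitInterval) :
    (resamplePair (1 - p)).map Prod.snd = gaussianReal 0 1 := by
  refine Measure.ext_of_lintegral _ fun F hF => ?_
  rw [lintegral_map hF (by fun_prop), lintegral_resamplePair _ (by fun_prop)]
  simp only [lintegral_const, measure_univ, mul_one, sub_sub_cancel]
  rw [← add_mul, ← ENNReal.ofReal_add (sub_nonneg.2 p.2.2) p.2.1]
  simp

variable {E : Type*} [Fintype E]

/-- The expectation is split over the set `S` of edges left unchanged, which gives `2 ^ card E`
terms. If `S` is small, flipping `X` outside `S` negates `f(X)` but not `f(Y)`, since `Y` does not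
see `X` there; otherwise the term is at most the probability that all of `S` is unchanged. -/
theorem corr_resamplePair_le {f : (E → ℝ) → ℝ} (hf : Measurable f) (h1 : ∀ x, |f x| ≤ 1) {m : ℕ}
    (hm : FlipsOffSmallSets f m) (p : unitInterval) :
    corr f (resamplePair (1 - p)) ≤ 2 ^ Fintype.card E * (1 - (p : ℝ)) ^ m := by
  classical
  rw [← map_resample_eq_resamplePair, corr_map _ _ (by fun_prop) hf]
  set γ := Measure.pi fun _ : E => gaussianReal 0 1
  set ν := Measure.pi fun _ : E => resampleSource p
  set ff : (E → ℝ) × (E → ℝ × Bool) → ℝ :=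
    fun z => f (fun e => z.1 e) * f (fun e => resample (z.1 e, z.2 e)) with hff
  have hffm : Measurable ff := by fun_prop
  have hff1 : ∀ w, |ff w| ≤ 1 := fun w => abs_mul_le_one (h1 _) (h1 _)
  set A : Finset E → Set ((E → ℝ) × (E → ℝ × Bool)) :=
    fun S => {z | ∀ e, (z.2 e).2 = false ↔ e ∈ S} with hA
  have hAm : ∀ S, MeasurableSet (A S) := fun S => by
    have h2 : A S = ⋂ e, {z | (z.2 e).2 = decide (e ∉ S)} := by
      ext z
      simp only [A, Set.mem_ofPred_eq, Set.mem_iInter]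
      refine forall_congr' fun e => ?_
      by_cases he : e ∈ S <;> simp [he]
    rw [h2]
    exact MeasurableSet.iInter fun e => measurableSet_eq_fun (by fun_prop) (by fun_prop)
  have hind : ∀ z, ∑ S, (A S).indicator ff z = ff z := fun z => by
    rw [Finset.sum_eq_single (Finset.univ.filter fun e => (z.2 e).2 = false)]
    · rw [Set.indicator_of_mem]; simp [A]
    · intro S _ hS
      rw [Set.indicator_of_notMem]
      intro hz
      exact hS (by ext e; simpa using (hz e).symm)
    · simp
  have hi : Integrable ff (γ.prod ν) := integrable_of_abs_le_one hffm hff1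
  change ∫ z, ff z ∂γ.prod ν ≤ _
  simp_rw [← hind]
  rw [integral_finsetSum _ fun S _ => hi.indicator (hAm S)]
  have hp : 0 ≤ 1 - (p : ℝ) := sub_nonneg.2 p.2.2
  have hterm : ∀ S, ∫ z, (A S).indicator ff z ∂γ.prod ν ≤ (1 - (p : ℝ)) ^ m := by
    intro S
    rcases lt_or_ge S.card m with hlt | hge
    · obtain ⟨ε, hε, hεS, hflip⟩ := hm S hlt
      have hT : MeasurePreserving
          (Prod.map (fun (x : E → ℝ) e => ε e * x e) (id : (E → ℝ × Bool) → _))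
          (γ.prod ν) (γ.prod ν) :=
        (measurePreserving_pi _ _ fun e => measurePreserving_gaussianReal_sign (hε e)).prod
          (MeasurePreserving.id ν)
      rw [integral_eq_zero_of_comp_eq_neg hT (hi.indicator (hAm S)).aestronglyMeasurable]
      · positivity
      · intro z
        by_cases hz : z ∈ A S
        · have hz' : Prod.map (fun (x : E → ℝ) e => ε e * x e) (id : (E → ℝ × Bool) → _) z ∈ A S :=
            hz
          rw [Set.indicator_of_mem hz, Set.indicator_of_mem hz']
          have e1 : ∀ e, resample (ε e * z.1 e, z.2 e) = resample (z.1 e, z.2 e) := fun e => by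
            by_cases he : (z.2 e).2 = false
            · rw [hεS e ((hz e).1 he), one_mul]
            · simp [resample, he]
          simp only [ff, Prod.map_fst, Prod.map_snd, id, e1, hflip]
          ring
        · have hz' : Prod.map (fun (x : E → ℝ) e => ε e * x e) (id : (E → ℝ × Bool) → _) z ∉ A S :=
            hz
          rw [Set.indicator_of_notMem hz, Set.indicator_of_notMem hz', neg_zero]
    · have hsub : A S ⊆ Set.univ ×ˢ Set.univ.pi
          fun e => Set.univ ×ˢ (if e ∈ S then {false} else Set.univ) := by
        intro z hz
        refine ⟨Set.mem_univ _, fun e _ => ⟨Set.mem_univ _, ?_⟩⟩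
        by_cases he : e ∈ S
        · simpa [he] using (hz e).2 he
        · simp [he]
      calc ∫ z, (A S).indicator ff z ∂γ.prod ν
          ≤ ∫ z, (A S).indicator (fun _ => (1 : ℝ)) z ∂γ.prod ν :=
            integral_mono (hi.indicator (hAm S)) ((integrable_const _).indicator (hAm S))
              fun z => Set.indicator_le_indicator ((le_abs_self _).trans (hff1 z))
        _ = (γ.prod ν).real (A S) := by rw [integral_indicator_const _ (hAm S)]; simp
        _ ≤ (γ.prod ν).real (Set.univ ×ˢ Set.univ.pi
          fun e => Set.univ ×ˢ (if e ∈ S then {false} else Set.univ)) := measureReal_mono hsub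
        _ = (1 - (p : ℝ)) ^ S.card := by
          rw [measureReal_prod_prod, measureReal_def, measureReal_def, Measure.pi_pi,
            measure_univ, ENNReal.toReal_one, one_mul, ENNReal.toReal_prod]
          trans ∏ e, if e ∈ S then 1 - (p : ℝ) else 1
          swap
          · simp [Finset.prod_ite_mem]
          refine Finset.prod_congr rfl fun e _ => ?_
          rw [Measure.prod_prod, measure_univ, one_mul]
          by_cases he : e ∈ S
          · simp [he]
          · simp [he]
        _ ≤ (1 - (p : ℝ)) ^ m := pow_le_pow_of_le_one hp (by linarith [p.2.1]) hge
  calc _ ≤ ∑ _S : Finset E, (1 - (p : ℝ)) ^ m := Finset.sum_le_sum fun S _ => hterm S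
    _ = _ := by simp

theorem corr_resamplePair_le_pow {f : (E → ℝ) → ℝ} (hf : Measurable f) (h1 : ∀ x, |f x| ≤ 1)
    {m : ℕ} (hm : FlipsOffSmallSets f m) {ρ : ℝ} (hρ0 : 0 < ρ) (hρ1 : ρ < 1) :
    corr f (resamplePair ρ) ≤ ρ ^ m := by
  have hp : ∀ ρ : ℝ, 0 < ρ → ρ < 1 → ∃ p : unitInterval, ρ = 1 - p := fun ρ h0 h1 =>
    ⟨⟨1 - ρ, by linarith, by linarith⟩, by simp⟩
  refine le_pow_of_sq_le (φ := fun ρ => corr f (resamplePair ρ)) (C := 2 ^ Fintype.card E)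
    (ρ₀ := 1) one_pos
    (fun ρ h0 h1' => ?_) (fun ρ h0 _ h1' => ?_) hρ0 hρ1
  · obtain ⟨p, rfl⟩ := hp ρ h0 h1'
    have := corr_sq_le (gaussianReal 0 1) (resampleSource p) measurable_resample hf h1
    rwa [resamplePair_semigroup, map_resample_eq_resamplePair] at this
  · obtain ⟨p, rfl⟩ := hp ρ h0 h1'
    exact corr_resamplePair_le hf h1 hm p

end Resampling

/-! ### Gauge transformations and the two-point function. -/

section Gauge

variable {V : Type*} (G : SimpleGraph V)

/-- The product of the values of a spin configuration at the ends of an edge. -/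
def edgeProd (σ : V → ℤˣ) (e : G.edgeSet) : ℤˣ := ((e : Sym2 V).map σ).mul

variable {G} in
theorem edgeProd_mul (σ τ : V → ℤˣ) (e : G.edgeSet) :
    edgeProd G (σ * τ) e = edgeProd G σ e * edgeProd G τ e := by
  obtain ⟨e, he⟩ := e
  induction e with
  | h a b => simp [edgeProd, mul_mul_mul_comm]

variable [Fintype G.edgeSet]

theorem hamiltonian_eq (J : G.edgeSet → ℝ) (σ : V → ℤˣ) :
    hamiltonian G J σ = -∑ e, J e * ((edgeProd G σ e : ℤ) : ℝ) := rfl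

/-- The gauge transformation of an environment by a spin configuration. -/
def gauge (s : V → ℤˣ) (J : G.edgeSet → ℝ) (e : G.edgeSet) : ℝ :=
  ((edgeProd G s e : ℤ) : ℝ) * J e

theorem hamiltonian_gauge (s : V → ℤˣ) (J : G.edgeSet → ℝ) (τ : V → ℤˣ) :
    hamiltonian G (gauge G s J) τ = hamiltonian G J (s * τ) := by
  simp only [hamiltonian_eq, gauge, edgeProd_mul]
  congr 1
  refine Finset.sum_congr rfl fun e _ => ?_
  push_cast
  ring

/-- As `s = 1` on `B`, multiplication by `s` is an involution of the states satisfying the boundary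
condition. -/
theorem isGroundState_gauge_iff {B : Finset V} {η : B → ℤˣ} {s : V → ℤˣ} (hs : ∀ k ∈ B, s k = 1)
    (J : G.edgeSet → ℝ) (τ : V → ℤˣ) :
    IsGroundState G B η (gauge G s J) τ ↔ IsGroundState G B η J (s * τ) := by
  have hb : ∀ τ : V → ℤˣ, (∀ i : B, (s * τ) i = η i) ↔ ∀ i : B, τ i = η i := fun τ =>
    forall_congr' fun i => by rw [Pi.mul_apply, hs i i.2, one_mul]
  have hss : s * s = 1 := by ext k; simp
  simp only [IsGroundState, hb, hamiltonian_gauge]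
  refine and_congr_right fun _ => ⟨fun h τ' hτ' => ?_, fun h τ' hτ' => h _ ((hb τ').2 hτ')⟩
  have := h (s * τ') ((hb τ').2 hτ')
  rwa [← mul_assoc, hss, one_mul] at this

theorem measurable_hamiltonian (τ : V → ℤˣ) : Measurable fun J => hamiltonian G J τ := by
  unfold hamiltonian; fun_prop

theorem measurableSet_isGroundState [Finite V] (B : Finset V) (η : B → ℤˣ) (τ : V → ℤˣ) :
    MeasurableSet {J | IsGroundState G B η J τ} := by
  by_cases h : ∀ i : B, τ i = η i
  · have : {J | IsGroundState G B η J τ} = ⋂ τ' : V → ℤˣ, ⋂ _ : ∀ i : B, τ' i = η i,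
        {J | hamiltonian G J τ ≤ hamiltonian G J τ'} := by
      ext J
      simp only [IsGroundState, h, Set.mem_ofPred_eq, Set.mem_iInter, implies_true, true_and]
    exact this ▸ MeasurableSet.iInter fun τ' => MeasurableSet.iInter fun _ =>
      measurableSet_le (measurable_hamiltonian G τ) (measurable_hamiltonian G τ')
  · convert MeasurableSet.empty
    ext J
    simp only [IsGroundState, h, Set.mem_ofPred_eq, false_and, Set.mem_empty_iff_false]

variable [Fintype V] [DecidableEq V] (B : Finset V) (η : B → ℤˣ)

open Classical in
/-- The finite set of ground states. -/
noncomputable def groundStates (J : G.edgeSet → ℝ) : Finset (V → ℤˣ) :=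
  Finset.univ.filter fun τ => IsGroundState G B η J τ

/-- The two-point function `σ_i σ_j`, averaged over the ground states `σ`. -/
noncomputable def twoPoint (i j : V) (J : G.edgeSet → ℝ) : ℝ :=
  (∑ τ ∈ groundStates G B η J, ((τ i * τ j : ℤˣ) : ℝ)) / (groundStates G B η J).card

theorem abs_units_cast (u : ℤˣ) : |((u : ℤ) : ℝ)| = 1 := by
  rcases Int.units_eq_one_or u with rfl | rfl <;> simp

theorem abs_twoPoint_le_one (i j : V) (J : G.edgeSet → ℝ) : |twoPoint G B η i j J| ≤ 1 := by
  rw [twoPoint, abs_div, Nat.abs_cast]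
  refine div_le_one_of_le₀ ((Finset.abs_sum_le_sum_abs _ _).trans ?_) (Nat.cast_nonneg _)
  simp [-Units.val_mul, -Int.cast_mul, abs_units_cast]

@[fun_prop]
theorem measurable_twoPoint (i j : V) : Measurable (twoPoint G B η i j) := by
  classical
  have h : twoPoint G B η i j = fun J =>
      (∑ τ : V → ℤˣ, {J | IsGroundState G B η J τ}.indicator
        (fun _ => ((τ i * τ j : ℤˣ) : ℝ)) J) /
      ∑ τ : V → ℤˣ, {J | IsGroundState G B η J τ}.indicator (fun _ => (1 : ℝ)) J := by
    ext J
    simp only [twoPoint, groundStates, Finset.sum_filter, Finset.card_eq_sum_ones,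
      Set.indicator_apply, Set.mem_ofPred_eq]
    push_cast
    rfl
  rw [h]
  exact (Finset.measurable_sum _ fun τ _ => measurable_const.indicator
    (measurableSet_isGroundState G B η τ)).div (Finset.measurable_sum _ fun τ _ =>
      measurable_const.indicator (measurableSet_isGroundState G B η τ))

variable {B} in
-- Multiplication by `s` matches the ground states of the two environments. Because `twoPoint`
-- averages over all of them, the identity holds for every `J`, including environments with ties.
theorem twoPoint_gauge {s : V → ℤˣ} (hs : ∀ k ∈ B, s k = 1) (i j : V) (J : G.edgeSet → ℝ) :
    twoPoint G B η i j (gauge G s J) = ((s i * s j : ℤˣ) : ℝ) * twoPoint G B η i j J := by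
  classical
  have hss : s * s = 1 := by ext k; simp
  have himg : groundStates G B η J = (groundStates G B η (gauge G s J)).image (s * ·) := by
    ext τ
    simp only [groundStates, Finset.mem_filter, Finset.mem_univ, true_and, Finset.mem_image,
      isGroundState_gauge_iff G hs]
    refine ⟨fun h => ⟨s * τ, ?_, ?_⟩, ?_⟩
    · rwa [← mul_assoc, hss, one_mul]
    · rw [← mul_assoc, hss, one_mul]
    · rintro ⟨τ', h, rfl⟩; exact h
  have hinj : Function.Injective (s * · : (V → ℤˣ) → V → ℤˣ) := mul_right_injective s
  rw [twoPoint, twoPoint, himg, Finset.card_image_of_injective _ hinj,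
    Finset.sum_image hinj.injOn, ← mul_div_assoc, Finset.mul_sum]
  congr 1
  refine Finset.sum_congr rfl fun τ _ => ?_
  have h : s i * s j * ((s * τ) i * (s * τ) j) = τ i * τ j := by
    rw [Pi.mul_apply, Pi.mul_apply, mul_mul_mul_comm (s i) (τ i), ← mul_assoc, Int.units_mul_self,
      one_mul]
  rw [← Int.cast_mul, ← Units.val_mul, h]

theorem twoPoint_eq {i j : V} {J : G.edgeSet → ℝ}
    (hu : ∀ τ τ', IsGroundState G B η J τ → IsGroundState G B η J τ' → τ i * τ j = τ' i * τ' j)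
    {σ : V → ℤˣ} (hσ : IsGroundState G B η J σ) :
    twoPoint G B η i j J = ((σ i * σ j : ℤˣ) : ℝ) := by
  classical
  have hmem : σ ∈ groundStates G B η J := by simp [groundStates, hσ]
  have hc : ((groundStates G B η J).card : ℝ) ≠ 0 :=
    Nat.cast_ne_zero.2 (Finset.card_ne_zero_of_mem hmem)
  rw [twoPoint, Finset.sum_congr rfl (g := fun _ => ((σ i * σ j : ℤˣ) : ℝ)), Finset.sum_const,
    nsmul_eq_mul, mul_div_cancel_left₀ _ hc]
  intro τ hτ
  rw [hu τ σ (by simpa [groundStates] using hτ) hσ]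

end Gauge

/-! ### Small edge sets do not connect distant vertices. -/

section Reachability

variable {V : Type*} {G : SimpleGraph V}

/-- The graph formed by a finite set of edges of `G`. -/
def edgeGraph (S : Finset G.edgeSet) : SimpleGraph V :=
  SimpleGraph.fromEdgeSet (Subtype.val '' (S : Set G.edgeSet))

/-- A path repeats no edge, so one within `S` has length at most `S.card`. -/
theorem dist_le_card_of_reachable (S : Finset G.edgeSet) {i j : V}
    (h : (edgeGraph S).Reachable i j) :
    G.dist i j ≤ S.card := by
  classical
  obtain ⟨p⟩ := h
  have hle : edgeGraph S ≤ G := by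
    rw [edgeGraph, SimpleGraph.fromEdgeSet_le]
    rintro _ ⟨⟨e, -, rfl⟩, -⟩
    exact e.2
  have hp := p.toPath.2
  generalize (p.toPath : (edgeGraph S).Walk i j) = q at hp
  calc G.dist i j ≤ (q.mapLe hle).length := SimpleGraph.dist_le _
    _ = q.edges.toFinset.card := by
      rw [List.toFinset_card_of_nodup hp.isTrail.edges_nodup]; simp
    _ ≤ (S.image Subtype.val).card := by
      refine Finset.card_le_card fun e he => ?_
      have := q.edges_subset_edgeSet (List.mem_toFinset.1 he)
      rw [edgeGraph, SimpleGraph.edgeSet_fromEdgeSet] at this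
      obtain ⟨⟨e', he', rfl⟩, -⟩ := this
      exact Finset.mem_image_of_mem _ he'
    _ ≤ S.card := Finset.card_image_le

/-- Take `s = -1` exactly on the component of `i` in the graph of `S`: no edge of `S` leaves it, and
it misses `j` and `B`. -/
theorem exists_flip_of_not_reachable (B : Finset V) (S : Finset G.edgeSet) {i j : V}
    (hij : ¬(edgeGraph S).Reachable i j)
    (hB : ∀ k ∈ B, ¬(edgeGraph S).Reachable i k) :
    ∃ s : V → ℤˣ, (∀ k ∈ B, s k = 1) ∧ (∀ e ∈ S, edgeProd G s e = 1) ∧ s i * s j = -1 := by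
  classical
  refine ⟨fun k => if (edgeGraph S).Reachable i k then -1 else 1, fun k hk => if_neg (hB k hk), ?_, ?_⟩
  · rintro ⟨e, he⟩ heS
    induction e with
    | h a b =>
      have hab : (edgeGraph S).Adj a b := by
        rw [edgeGraph, SimpleGraph.fromEdgeSet_adj]
        exact ⟨⟨_, heS, rfl⟩, SimpleGraph.Adj.ne he⟩
      have hiff : (edgeGraph S).Reachable i a ↔ (edgeGraph S).Reachable i b :=
        ⟨fun h => h.trans hab.reachable, fun h => h.trans hab.symm.reachable⟩
      by_cases hb : (edgeGraph S).Reachable i b <;> simp [edgeProd, hiff, hb]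
  · simp [hij]

theorem prod_eq_of_edgeProd_eq (hG : G.Connected) {τ τ' : V → ℤˣ}
    (h : ∀ e, edgeProd G τ e = edgeProd G τ' e) (i j : V) : τ i * τ j = τ' i * τ' j := by
  obtain ⟨p⟩ := hG i j
  induction p with
  | nil => simp
  | @cons a b c hab p ih =>
    have h1 : τ a * τ b = τ' a * τ' b := h ⟨s(a, b), hab⟩
    calc τ a * τ c = (τ a * τ b) * (τ b * τ c) := by
          rw [mul_assoc, ← mul_assoc (τ b), Int.units_mul_self, one_mul]
      _ = (τ' a * τ' b) * (τ' b * τ' c) := by rw [h1, ih]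
      _ = τ' a * τ' c := by rw [mul_assoc, ← mul_assoc (τ' b), Int.units_mul_self, one_mul]

variable [Fintype V] [DecidableEq V] [Fintype G.edgeSet] (B : Finset V) (η : B → ℤˣ)

/-- It is enough that one endpoint be far from `B`, since only the component of that endpoint is
reversed. -/
theorem flipsOffSmallSets_twoPoint {i j : V} {m : ℕ} (hij : m ≤ G.dist i j)
    (hB : (∀ k ∈ B, m ≤ G.dist i k) ∨ ∀ k ∈ B, m ≤ G.dist j k) :
    FlipsOffSmallSets (twoPoint G B η i j) m := by
  intro S hS
  have hn : ∀ a b, m ≤ G.dist a b → ¬(edgeGraph S).Reachable a b := fun a b hab h =>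
    absurd ((hab.trans (dist_le_card_of_reachable S h)).trans_lt hS) (lt_irrefl _)
  obtain ⟨s, hsB, hsS, hs⟩ : ∃ s : V → ℤˣ, (∀ k ∈ B, s k = 1) ∧
      (∀ e ∈ S, edgeProd G s e = 1) ∧ s i * s j = -1 := by
    rcases hB with hB | hB
    · exact exists_flip_of_not_reachable B S (hn i j hij) fun k hk => hn i k (hB k hk)
    · obtain ⟨s, h1, h2, h3⟩ := exists_flip_of_not_reachable B S
        (fun h => hn i j hij h.symm) fun k hk => hn j k (hB k hk)
      exact ⟨s, h1, h2, by rw [mul_comm, h3]⟩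
  refine ⟨fun e => ((edgeProd G s e : ℤ) : ℝ), fun e => ?_, fun e he => by simp [hsS e he],
    fun J => ?_⟩
  · rcases Int.units_eq_one_or (edgeProd G s e) with h | h <;> simp [h]
  · have := twoPoint_gauge G η hsB i j J
    rw [hs] at this
    exact this.trans (by simp)

end Reachability

/-! ### Almost sure uniqueness of ground states. -/

section Uniqueness

theorem gaussianDisorder_absolutelyContinuous (E : Type*) [Fintype E] :
    gaussianDisorder E ≪ (volume : Measure (E → ℝ)) := by
  unfold gaussianDisorder
  rw [gaussianReal_of_var_ne_zero 0 one_ne_zero]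
  unfold gaussianPDF
  rw [pi_withDensity_ofReal _ (integrable_gaussianPDFReal 0 1) (gaussianPDFReal_nonneg 0 1)]
  exact withDensity_absolutelyContinuous _ _

/-- The kernel of a nonzero linear form is a proper subspace, hence Lebesgue null. -/
theorem ae_sum_mul_ne_zero {E : Type*} [Fintype E] {c : E → ℝ} (hc : c ≠ 0) :
    ∀ᵐ J ∂gaussianDisorder E, ∑ e, J e * c e ≠ 0 := by
  classical
  refine Measure.AbsolutelyContinuous.ae_le (gaussianDisorder_absolutelyContinuous E) ?_
  change ∀ᵐ J : E → ℝ, ∑ e, J e * c e ≠ 0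
  have h := Measure.addHaar_submodule (volume : Measure (E → ℝ))
    (LinearMap.ker (Fintype.linearCombination ℝ c)) (fun htop => hc ?_)
  · rw [ae_iff]
    convert h using 2
    ext J
    simp [Fintype.linearCombination_apply]
  · ext e
    have : (Pi.single e 1 : E → ℝ) ∈ LinearMap.ker (Fintype.linearCombination ℝ c) := by
      rw [htop]; trivial
    simpa [Fintype.linearCombination_apply_single] using this

variable {V : Type*} [Finite V] {G : SimpleGraph V} [Fintype G.edgeSet]

/-- Almost surely, any two ground states have the same two-point products. -/
theorem ae_groundState_unique (hG : G.Connected) (B : Finset V) (η : B → ℤˣ) :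
    ∀ᵐ J ∂gaussianDisorder G.edgeSet, ∀ i j τ τ', IsGroundState G B η J τ →
      IsGroundState G B η J τ' → τ i * τ j = τ' i * τ' j := by
  -- States with different edge products differ in energy by a nonzero linear form in `J`. Equal
  -- edge products suffice afterwards, as they determine `τ i * τ j` along a path; this covers the
  -- global sign when `B = ∅`.
  have h : ∀ᵐ J ∂gaussianDisorder G.edgeSet, ∀ τ τ' : V → ℤˣ,
      (∃ e, edgeProd G τ e ≠ edgeProd G τ' e) → hamiltonian G J τ ≠ hamiltonian G J τ' := by
    rw [ae_all_iff]; intro τ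
    rw [ae_all_iff]; intro τ'
    by_cases hex : ∃ e, edgeProd G τ e ≠ edgeProd G τ' e
    · have hc : (fun e => ((edgeProd G τ e : ℤ) : ℝ) - ((edgeProd G τ' e : ℤ) : ℝ)) ≠ 0 := by
        obtain ⟨e, he⟩ := hex
        intro h0
        have := congrFun h0 e
        simp only [Pi.zero_apply, sub_eq_zero, Int.cast_inj, Units.val_inj] at this
        exact he this
      filter_upwards [ae_sum_mul_ne_zero hc] with J hJ _ heq
      apply hJ
      simp only [hamiltonian_eq, neg_inj] at heq
      simp only [mul_sub, Finset.sum_sub_distrib, heq, sub_self]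
    · exact ae_of_all _ fun _ h => absurd h hex
  filter_upwards [h] with J hJ i j τ τ' hτ hτ'
  refine prod_eq_of_edgeProd_eq hG (fun e => ?_) i j
  by_contra hne
  exact hJ τ τ' ⟨e, hne⟩ (le_antisymm (hτ.2 τ' hτ'.1) (hτ'.2 τ hτ.1))

end Uniqueness

/-! ### Exponential sums under polynomial growth. -/

section LayerSum

/-- The constant of the bound on exponential sums over sets of polynomial growth `β`. -/
noncomputable def layerConst (β : ℝ) : ℝ := ∑' n : ℕ, Real.exp (-n) * ((n : ℝ) + 1) ^ β

theorem summable_layer (β : ℝ) : Summable fun n : ℕ => Real.exp (-n) * ((n : ℝ) + 1) ^ β := by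
  obtain ⟨k, hk⟩ := exists_nat_ge β
  have h := ((summable_nat_add_iff 1).2
    (Real.summable_pow_mul_exp_neg_nat_mul k one_pos)).mul_left (Real.exp 1)
  refine Summable.of_nonneg_of_le (fun n => by positivity) (fun n => ?_) h
  have h1 : ((n : ℝ) + 1) ^ β ≤ ((n : ℝ) + 1) ^ k := by
    rw [← Real.rpow_natCast]
    exact Real.rpow_le_rpow_of_exponent_le (by linarith [Nat.cast_nonneg (α := ℝ) n]) hk
  calc Real.exp (-n) * ((n : ℝ) + 1) ^ β ≤ Real.exp (-n) * ((n : ℝ) + 1) ^ k := by gcongr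
    _ = Real.exp 1 * (((n + 1 : ℕ) : ℝ) ^ k * Real.exp (-1 * ((n + 1 : ℕ) : ℝ))) := by
      rw [mul_left_comm, ← Real.exp_add]
      push_cast
      ring_nf

theorem layerConst_pos (β : ℝ) : 0 < layerConst β :=
  (summable_layer β).tsum_pos (fun n => by positivity) 0 (by positivity)

/-- The points are sorted by `n = ⌊q D⌋`. Those in layer `n` satisfy `D ≤ (n + 1) / q`, a radius at
least `1` because `q ≤ 1`, and each contributes at most `exp (-n)`. -/
theorem sum_exp_neg_le {ι : Type*} (s : Finset ι) (D : ι → ℕ) {A β : ℝ} (hA : 0 ≤ A)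
    (hD : ∀ r : ℝ, 1 ≤ r → ((s.filter fun j => (D j : ℝ) ≤ r).card : ℝ) ≤ A * r ^ β) {q : ℝ}
    (hq0 : 0 < q) (hq1 : q ≤ 1) :
    ∑ j ∈ s, Real.exp (-(q * D j)) ≤ layerConst β * A * q ^ (-β) := by
  set N := s.sup (fun j => ⌊q * D j⌋₊) + 1
  have h1 : ∀ j ∈ s, Real.exp (-(q * D j)) ≤
      ∑ n ∈ Finset.range N, if (D j : ℝ) ≤ ((n : ℝ) + 1) / q then Real.exp (-n) else 0 := by
    intro j hj
    have hmem : ⌊q * D j⌋₊ ∈ Finset.range N :=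
      Finset.mem_range.2 (Nat.lt_succ_of_le (Finset.le_sup (f := fun j => ⌊q * D j⌋₊) hj))
    refine le_trans ?_ (Finset.single_le_sum (fun n _ => by split_ifs <;> positivity) hmem)
    rw [if_pos]
    · exact Real.exp_le_exp.2 (neg_le_neg (Nat.floor_le (by positivity)))
    · rw [le_div_iff₀ hq0, mul_comm]; exact (Nat.lt_floor_add_one _).le
  have h2 : ∀ n : ℕ, ∑ j ∈ s, (if (D j : ℝ) ≤ ((n : ℝ) + 1) / q then Real.exp (-n) else 0) ≤
      A * q ^ (-β) * (Real.exp (-n) * ((n : ℝ) + 1) ^ β) := by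
    intro n
    have hn : (0 : ℝ) ≤ n := Nat.cast_nonneg n
    have hr : 1 ≤ ((n : ℝ) + 1) / q := by rw [le_div_iff₀ hq0]; linarith
    rw [← Finset.sum_filter, Finset.sum_const, nsmul_eq_mul]
    calc _ ≤ A * (((n : ℝ) + 1) / q) ^ β * Real.exp (-n) := by gcongr; exact hD _ hr
      _ = _ := by
        rw [Real.div_rpow (by positivity) hq0.le, Real.rpow_neg hq0.le]
        ring
  calc ∑ j ∈ s, Real.exp (-(q * D j))
      ≤ ∑ j ∈ s, ∑ n ∈ Finset.range N,
          (if (D j : ℝ) ≤ ((n : ℝ) + 1) / q then Real.exp (-n) else 0) := Finset.sum_le_sum h1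
    _ = ∑ n ∈ Finset.range N, ∑ j ∈ s,
          (if (D j : ℝ) ≤ ((n : ℝ) + 1) / q then Real.exp (-n) else 0) := Finset.sum_comm
    _ ≤ ∑ n ∈ Finset.range N, A * q ^ (-β) * (Real.exp (-n) * ((n : ℝ) + 1) ^ β) :=
        Finset.sum_le_sum fun n _ => h2 n
    _ ≤ A * q ^ (-β) * layerConst β := by
        rw [← Finset.mul_sum]
        gcongr
        exact (summable_layer β).sum_le_tsum _ fun n _ => by positivity
    _ = _ := by ring

end LayerSum

/-! ### From two-point correlations to the overlap. -/

section Overlap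

variable {V : Type*} [Fintype V] [DecidableEq V] {G : SimpleGraph V} [Fintype G.edgeSet]

/-- A law of a pair of correlated standard Gaussian variables whose independent copies decorrelate
functions at rate `ρ` per coordinate. -/
structure IsDecorrelating (m : Measure (ℝ × ℝ)) (ρ : ℝ) : Prop where
  map_fst : m.map Prod.fst = gaussianReal 0 1
  map_snd : m.map Prod.snd = gaussianReal 0 1
  corr_le : ∀ (f : (G.edgeSet → ℝ) → ℝ), Measurable f → (∀ x, |f x| ≤ 1) → ∀ n : ℕ,
    FlipsOffSmallSets f n → corr f m ≤ ρ ^ n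

theorem siteOverlap_sq (B : Finset V) (σ σ' : V → ℤˣ) :
    siteOverlap B σ σ' ^ 2 = (1 / (Bᶜ.card : ℝ)) ^ 2 *
      ∑ i ∈ Bᶜ, ∑ j ∈ Bᶜ, ((σ i * σ j : ℤˣ) : ℝ) * ((σ' i * σ' j : ℤˣ) : ℝ) := by
  rw [siteOverlap, mul_pow, sq (∑ i ∈ Bᶜ, _), Finset.sum_mul_sum]
  congr 1
  refine Finset.sum_congr rfl fun i _ => Finset.sum_congr rfl fun j _ => ?_
  push_cast
  ring

/-- The distance of a vertex to `B`. -/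
noncomputable def distTo (G : SimpleGraph V) (B : Finset V) (j : V) : ℕ :=
  sInf {n | ∃ k ∈ B, G.dist j k = n}

/-- The exponential of a minimum is bounded by a sum, and the maximum of the two boundary distances
is at least their mean. The resulting product form lets the double sum factor. For empty `B`,
`distTo` defaults to `0`, so the weight is set to `0` separately, as for infinite distance. -/
theorem corr_twoPoint_le {m : Measure (ℝ × ℝ)} {p : ℝ} (hm : IsDecorrelating (G := G) m (1 - p))
    (hp0 : 0 ≤ p) (hp1 : p ≤ 1) (B : Finset V) (η : B → ℤˣ) (i j : V) :
    corr (twoPoint G B η i j) m ≤ Real.exp (-(p * G.dist i j)) +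
      (if B.Nonempty then Real.exp (-(p / 2 * distTo G B i)) else 0) *
      (if B.Nonempty then Real.exp (-(p / 2 * distTo G B j)) else 0) := by
  have hle : ∀ n : ℕ, FlipsOffSmallSets (twoPoint G B η i j) n →
      corr (twoPoint G B η i j) m ≤ Real.exp (-(p * n)) := fun n hn => by
    refine (hm.corr_le _ (measurable_twoPoint G B η i j) (abs_twoPoint_le_one G B η i j) n hn).trans
      ?_
    calc (1 - p) ^ n ≤ Real.exp (-p) ^ n :=
          pow_le_pow_left₀ (by linarith) (Real.one_sub_le_exp_neg p) n
      _ = _ := by rw [← Real.exp_nat_mul]; ring_nf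
  have hd : ∀ a, ∀ k ∈ B, distTo G B a ≤ G.dist a k := fun a k hk => Nat.sInf_le ⟨k, hk, rfl⟩
  by_cases hB : B.Nonempty
  · simp only [hB, if_true]
    set Di := distTo G B i
    set Dj := distTo G B j
    have h := hle (min (G.dist i j) (max Di Dj))
      (flipsOffSmallSets_twoPoint B η (min_le_left _ _) (by
        rcases le_total Di Dj with h | h
        · exact Or.inr fun k hk => (min_le_right _ _).trans ((max_le h le_rfl).trans (hd j k hk))
        · exact Or.inl fun k hk => (min_le_right _ _).trans ((max_le le_rfl h).trans (hd i k hk))))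
    refine h.trans ?_
    rcases min_choice (G.dist i j) (max Di Dj) with hmin | hmin
    · rw [hmin]
      exact le_add_of_nonneg_right (by positivity)
    · rw [hmin, ← Real.exp_add]
      refine le_add_of_nonneg_of_le (by positivity) (Real.exp_le_exp.2 ?_)
      have hDi : (Di : ℝ) ≤ (max Di Dj : ℕ) := Nat.cast_le.2 (le_max_left _ _)
      have hDj : (Dj : ℝ) ≤ (max Di Dj : ℕ) := Nat.cast_le.2 (le_max_right _ _)
      nlinarith
  · simp only [hB, if_false, mul_zero, add_zero]
    rw [Finset.not_nonempty_iff_eq_empty] at hB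
    refine hle _ (flipsOffSmallSets_twoPoint B η le_rfl (Or.inl fun k hk => ?_))
    simp [hB] at hk

theorem integral_siteOverlap_sq {m : Measure (ℝ × ℝ)} [IsProbabilityMeasure m] {ρ : ℝ}
    (hm : IsDecorrelating (G := G) m ρ) (hG : G.Connected) (B : Finset V) (η : B → ℤˣ)
    {Ω : Type*} [MeasurableSpace Ω] {P : Measure Ω} {J Jp : Ω → G.edgeSet → ℝ}
    (hlaw : HasLaw (fun ω e => (J ω e, Jp ω e)) (Measure.pi fun _ => m) P)
    {σ σ' : Ω → V → ℤˣ} (hσ : ∀ᵐ ω ∂P, IsGroundState G B η (J ω) (σ ω))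
    (hσ' : ∀ᵐ ω ∂P, IsGroundState G B η (Jp ω) (σ' ω)) :
    Integrable (fun ω => siteOverlap B (σ ω) (σ' ω) ^ 2) P ∧
      ∫ ω, siteOverlap B (σ ω) (σ' ω) ^ 2 ∂P = (1 / (Bᶜ.card : ℝ)) ^ 2 *
        ∑ i ∈ Bᶜ, ∑ j ∈ Bᶜ, corr (twoPoint G B η i j) m := by
  have := hlaw.isProbabilityMeasure
  have hmarg : ∀ g : ℝ × ℝ → ℝ, Measurable g → m.map g = gaussianReal 0 1 →
      HasLaw (fun ω e => g (J ω e, Jp ω e)) (gaussianDisorder G.edgeSet) P := by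
    intro g hg hmg
    have : IsProbabilityMeasure (m.map g) := by rw [hmg]; infer_instance
    have h2 : HasLaw (fun (w : G.edgeSet → ℝ × ℝ) e => g (w e)) (gaussianDisorder G.edgeSet)
        (Measure.pi fun _ => m) :=
      ⟨(measurable_pi_lambda _ fun e => hg.comp (measurable_pi_apply e)).aemeasurable,
        by rw [Measure.pi_map_pi fun _ => hg.aemeasurable, hmg]; rfl⟩
    exact h2.fun_comp hlaw
  have hJ := hmarg Prod.fst measurable_fst hm.map_fst
  have hJp := hmarg Prod.snd measurable_snd hm.map_snd
  have hu := ae_groundState_unique hG B η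
  have hu1 := ae_of_ae_map hJ.aemeasurable (hJ.map_eq ▸ hu)
  have hu2 := ae_of_ae_map hJp.aemeasurable (hJp.map_eq ▸ hu)
  set F : V → V → (G.edgeSet → ℝ × ℝ) → ℝ := fun i j w =>
    twoPoint G B η i j (fun e => (w e).1) * twoPoint G B η i j (fun e => (w e).2) with hF
  have hFm : ∀ i j, Measurable (F i j) := fun i j =>
    ((measurable_twoPoint G B η i j).comp (by fun_prop)).mul
      ((measurable_twoPoint G B η i j).comp (by fun_prop))
  have hFi : ∀ i j, Integrable (fun ω => F i j fun e => (J ω e, Jp ω e)) P := fun i j =>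
    Integrable.of_bound ((hFm i j).comp_aemeasurable hlaw.aemeasurable).aestronglyMeasurable 1
      (ae_of_all _ fun ω => abs_mul_le_one (abs_twoPoint_le_one _ _ _ _ _ _)
        (abs_twoPoint_le_one _ _ _ _ _ _))
  -- The selections `σ`, `σ'` need not be measurable; integrability comes from this almost sure
  -- equality with a measurable function of the environments.
  have hae : (fun ω => (1 / (Bᶜ.card : ℝ)) ^ 2 *
      ∑ i ∈ Bᶜ, ∑ j ∈ Bᶜ, F i j fun e => (J ω e, Jp ω e)) =ᵐ[P]
      fun ω => siteOverlap B (σ ω) (σ' ω) ^ 2 := by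
    filter_upwards [hu1, hu2, hσ, hσ'] with ω h1 h2 h3 h4
    rw [siteOverlap_sq]
    congr 1
    refine Finset.sum_congr rfl fun i _ => Finset.sum_congr rfl fun j _ => ?_
    rw [← twoPoint_eq G B η (h1 i j) h3, ← twoPoint_eq G B η (h2 i j) h4]
  have hint : Integrable (fun ω => ∑ i ∈ Bᶜ, ∑ j ∈ Bᶜ, F i j fun e => (J ω e, Jp ω e)) P :=
    integrable_finsetSum _ fun i _ => integrable_finsetSum _ fun j _ => hFi i j
  refine ⟨(hint.const_mul _).congr hae, ?_⟩
  rw [← integral_congr_ae hae, integral_const_mul,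
    integral_finsetSum _ fun i _ => integrable_finsetSum _ fun j _ => hFi i j]
  congr 1
  refine Finset.sum_congr rfl fun i _ => ?_
  rw [integral_finsetSum _ fun j _ => hFi i j]
  exact Finset.sum_congr rfl fun j _ =>
    hlaw.integral_comp (f := F i j) (hFm i j).aestronglyMeasurable

theorem sum_corr_twoPoint_le {m : Measure (ℝ × ℝ)} {p : ℝ}
    (hm : IsDecorrelating (G := G) m (1 - p)) (hp0 : 0 < p) (hp1 : p ≤ 1) (B : Finset V)
    (η : B → ℤˣ) {α β γ δ : ℝ} (hα : 0 ≤ α) (hγ : 0 ≤ γ)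
    (hball : ∀ i ∉ B, ∀ r : ℝ, 1 ≤ r →
      (({j : V | (G.dist i j : ℝ) ≤ r}.ncard : ℕ) : ℝ) ≤ α * r ^ β)
    (hbdry : ∀ r : ℝ, 1 ≤ r →
      (({j : V | ∃ k ∈ B, (G.dist j k : ℝ) ≤ r}.ncard : ℕ) : ℝ) ≤ γ * (B.card : ℝ) * r ^ δ) :
    ∑ i ∈ Bᶜ, ∑ j ∈ Bᶜ, corr (twoPoint G B η i j) m ≤
      (layerConst β * α + (layerConst δ * γ * 2 ^ δ) ^ 2) *
        ((Bᶜ.card : ℝ) * p ^ (-β) + (B.card : ℝ) ^ 2 * p ^ (-(2 * δ))) := by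
  set w : V → ℝ := fun j => if B.Nonempty then Real.exp (-(p / 2 * distTo G B j)) else 0 with hw
  have hw0 : 0 ≤ ∑ j ∈ Bᶜ, w j := Finset.sum_nonneg fun j _ => by
    simp only [w]; split_ifs <;> positivity
  have h1 : ∀ i ∈ Bᶜ, ∑ j ∈ Bᶜ, Real.exp (-(p * G.dist i j)) ≤ layerConst β * α * p ^ (-β) := by
    intro i hi
    refine sum_exp_neg_le _ _ hα (fun r hr => ?_) hp0 hp1
    refine le_trans ?_ (hball i (Finset.mem_compl.1 hi) r hr)
    rw [Nat.cast_le, ← Set.ncard_coe_finset]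
    exact Set.ncard_le_ncard (fun j hj => by simpa using (Finset.mem_filter.1 hj).2)
  have h2 : ∑ j ∈ Bᶜ, w j ≤ layerConst δ * (γ * B.card) * (p / 2) ^ (-δ) := by
    have hL := layerConst_pos δ
    by_cases hB : B.Nonempty
    · simp only [w, hB, if_true]
      refine sum_exp_neg_le _ _ (by positivity) (fun r hr => ?_) (by positivity) (by linarith)
      refine le_trans ?_ (hbdry r hr)
      rw [Nat.cast_le, ← Set.ncard_coe_finset]
      refine Set.ncard_le_ncard (fun j hj => ?_)
      have hne : {n | ∃ k ∈ B, G.dist j k = n}.Nonempty :=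
        ⟨_, hB.choose, hB.choose_spec, rfl⟩
      obtain ⟨k, hk, hjk⟩ := Nat.sInf_mem hne
      exact ⟨k, hk, by rw [hjk]; exact (Finset.mem_filter.1 hj).2⟩
    · simp only [w, hB, if_false, Finset.sum_const_zero]
      positivity
  have hp2 : (p / 2) ^ (-δ) = p ^ (-δ) * 2 ^ δ := by
    rw [Real.div_rpow hp0.le (by norm_num), Real.rpow_neg (by norm_num : (0 : ℝ) ≤ 2), div_inv_eq_mul]
  have hpsq : p ^ (-(2 * δ)) = (p ^ (-δ)) ^ 2 := by
    rw [← Real.rpow_mul_natCast hp0.le]; ring_nf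
  calc ∑ i ∈ Bᶜ, ∑ j ∈ Bᶜ, corr (twoPoint G B η i j) m
      ≤ ∑ i ∈ Bᶜ, ∑ j ∈ Bᶜ, (Real.exp (-(p * G.dist i j)) + w i * w j) :=
        Finset.sum_le_sum fun i _ => Finset.sum_le_sum fun j _ => corr_twoPoint_le hm hp0.le hp1 B η i j
    _ = ∑ i ∈ Bᶜ, ∑ j ∈ Bᶜ, Real.exp (-(p * G.dist i j)) + (∑ j ∈ Bᶜ, w j) ^ 2 := by
        simp only [Finset.sum_add_distrib]
        rw [sq, Finset.sum_mul_sum]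
    _ ≤ Bᶜ.card * (layerConst β * α * p ^ (-β)) +
        (layerConst δ * (γ * B.card) * (p / 2) ^ (-δ)) ^ 2 := by
        refine add_le_add ?_ (pow_le_pow_left₀ hw0 h2 2)
        rw [← nsmul_eq_mul]
        exact Finset.sum_le_card_nsmul _ _ _ h1
    _ = layerConst β * α * (Bᶜ.card * p ^ (-β)) +
        (layerConst δ * γ * 2 ^ δ) ^ 2 * ((B.card : ℝ) ^ 2 * p ^ (-(2 * δ))) := by
        rw [hp2, hpsq]; ring
    _ ≤ _ := by
        have ha : 0 ≤ layerConst β * α := mul_nonneg (layerConst_pos β).le hα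
        have hb : 0 ≤ (layerConst δ * γ * 2 ^ δ) ^ 2 := sq_nonneg _
        have hx : 0 ≤ (Bᶜ.card : ℝ) * p ^ (-β) := by positivity
        have hy : 0 ≤ (B.card : ℝ) ^ 2 * p ^ (-(2 * δ)) := by positivity
        nlinarith [mul_nonneg ha hy, mul_nonneg hb hx]

end Overlap

/-! ### Joint laws of the two perturbations. -/

section Perturbations

variable {E Ω : Type*} [Fintype E] [MeasurableSpace Ω] {P : Measure Ω} {p : unitInterval}
  {J Jp : Ω → E → ℝ}

theorem IsGaussianPerturbation.hasLaw (h : IsGaussianPerturbation P p J Jp) :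
    HasLaw (fun ω e => (J ω e, Jp ω e)) (Measure.pi fun _ => gaussianPair (1 - p)) P := by
  obtain ⟨J', hlaw, hJp⟩ := h
  have h2 := map_pi_prod_pi (E := E) (gaussianReal 0 1) (gaussianReal 0 1)
    (g := fun z => (z.1, (1 - (p : ℝ)) * z.1 + √(1 - (1 - (p : ℝ)) ^ 2) * z.2)) (by fun_prop)
  have h3 : HasLaw (fun ω e =>
      (J ω e, (1 - (p : ℝ)) * J ω e + √(1 - (1 - (p : ℝ)) ^ 2) * J' ω e))
      (Measure.pi fun _ => gaussianPair (1 - p)) P :=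
    HasLaw.fun_comp ⟨by fun_prop, h2⟩ hlaw
  have hs : 1 - (1 - (p : ℝ)) ^ 2 = 2 * p - (p : ℝ) ^ 2 := by ring
  simpa only [hJp, hs] using h3

theorem IsResamplingPerturbation.hasLaw (h : IsResamplingPerturbation P p J Jp) :
    HasLaw (fun ω e => (J ω e, Jp ω e)) (Measure.pi fun _ => resamplePair (1 - p)) P := by
  obtain ⟨J', ξ, hlaw, hJp⟩ := h
  -- The families `J'` and `ξ` are regrouped as one family of pairs, as `resampleSource` requires.
  have h1 := map_pi_prod_pi (E := E) (gaussianReal 0 1) (bernoulliMeasure true false p)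
    (g := id) measurable_id
  rw [Measure.map_id] at h1
  have h2 := map_pi_prod_pi (E := E) (gaussianReal 0 1) (resampleSource p)
    (g := fun z => (z.1, resample z)) (by fun_prop)
  rw [map_resample_eq_resamplePair,
    ← Measure.map_id (μ := Measure.pi fun _ : E => gaussianReal 0 1), ← h1,
    Measure.map_prod_map _ _ measurable_id (by fun_prop),
    Measure.map_map (by fun_prop) (by fun_prop)] at h2
  have h3 : HasLaw (fun ω e => (J ω e, resample (J ω e, J' ω e, ξ ω e)))
      (Measure.pi fun _ => resamplePair (1 - p)) P :=
    HasLaw.comp ⟨(by fun_prop : Measurable _).aemeasurable, h2⟩ hlaw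
  simpa only [resample, hJp] using h3

end Perturbations

end EdwardsAnderson

/-! ### The overlap bound. -/

theorem mainTheorem1 (α β γ δ : ℝ) (hα : 0 < α) (hβ : 0 < β) (hγ : 0 < γ) (hδ : 0 < δ) :
    ∃ C : ℝ, 0 < C ∧
      ∀ (V : Type*) [Fintype V] [DecidableEq V] (G : SimpleGraph V) [DecidableRel G.Adj]
        (B : Finset V) (η : B → ℤˣ),
        G.Connected →
        2 ≤ G.edgeFinset.card →
        -- the interior `V \ B` is nonempty and connected
        (G.induce ((B : Set V)ᶜ)).Connected →
        -- volume growth of balls around interior vertices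
        (∀ i ∉ B, ∀ r : ℝ, 1 ≤ r →
          (({j : V | (G.dist i j : ℝ) ≤ r}.ncard : ℕ) : ℝ) ≤ α * r ^ β) →
        -- volume growth of neighbourhoods of the boundary
        (∀ r : ℝ, 1 ≤ r →
          (({j : V | ∃ k ∈ B, (G.dist j k : ℝ) ≤ r}.ncard : ℕ) : ℝ) ≤ γ * (B.card : ℝ) * r ^ δ) →
        ∀ (Ω : Type*) [MeasurableSpace Ω] (P : Measure Ω) [IsProbabilityMeasure P]
          (p : unitInterval), 0 < p → p < 1 →
        ∀ J Jp : Ω → G.edgeSet → ℝ,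
          (EdwardsAnderson.IsGaussianPerturbation P p J Jp ∨
            EdwardsAnderson.IsResamplingPerturbation P p J Jp) →
        -- any choice of ground states in the original and in the perturbed environment
        ∀ σ σ' : Ω → V → ℤˣ,
          (∀ᵐ ω ∂P, EdwardsAnderson.IsGroundState G B η (J ω) (σ ω)) →
          (∀ᵐ ω ∂P, EdwardsAnderson.IsGroundState G B η (Jp ω) (σ' ω)) →
          Integrable (fun ω => EdwardsAnderson.siteOverlap B (σ ω) (σ' ω) ^ 2) P ∧
          ∫ ω, EdwardsAnderson.siteOverlap B (σ ω) (σ' ω) ^ 2 ∂P ≤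
            1 / (Bᶜ.card : ℝ) +
              C * ((Bᶜ.card : ℝ) * (p : ℝ) ^ (-β) + (B.card : ℝ) ^ 2 * (p : ℝ) ^ (-(2 * δ))) /
                (Bᶜ.card : ℝ) ^ 2 := by
  have hLβ := EdwardsAnderson.layerConst_pos β
  refine ⟨EdwardsAnderson.layerConst β * α + (EdwardsAnderson.layerConst δ * γ * 2 ^ δ) ^ 2,
    by positivity, ?_⟩
  intro V _ _ G _ B η hG _ _ hball hbdry Ω _ P _ p hp0 hp1 J Jp hJ σ σ' hσ hσ'
  have hp0' : 0 < (p : ℝ) := hp0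
  have hp1' : (p : ℝ) < 1 := hp1
  have hρ0 : 0 < 1 - (p : ℝ) := sub_pos.2 hp1'
  have hρ1 : 1 - (p : ℝ) < 1 := by linarith
  obtain ⟨m, hmp, hm, hlaw⟩ : ∃ m : Measure (ℝ × ℝ), IsProbabilityMeasure m ∧
      EdwardsAnderson.IsDecorrelating (G := G) m (1 - p) ∧
      HasLaw (fun ω e => (J ω e, Jp ω e)) (Measure.pi fun _ => m) P := by
    rcases hJ with h | h
    · exact ⟨_, inferInstance, ⟨EdwardsAnderson.gaussianPair_map_fst _,
        EdwardsAnderson.gaussianPair_map_snd hρ0.le hρ1.le, fun f hf h1 n hn =>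
        EdwardsAnderson.corr_gaussianPair_le_pow hf h1 hn hρ0 hρ1⟩, h.hasLaw⟩
    · exact ⟨_, EdwardsAnderson.isProbabilityMeasure_resamplePair p,
        ⟨EdwardsAnderson.resamplePair_map_fst p,
        EdwardsAnderson.resamplePair_map_snd p, fun f hf h1 n hn =>
        EdwardsAnderson.corr_resamplePair_le_pow hf h1 hn hρ0 hρ1⟩, h.hasLaw⟩
  obtain ⟨hint, heq⟩ := EdwardsAnderson.integral_siteOverlap_sq hm hG B η hlaw hσ hσ'
  refine ⟨hint, ?_⟩
  have hsum := EdwardsAnderson.sum_corr_twoPoint_le hm hp0' hp1'.le B η hα.le hγ.le hball hbdry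
  rw [heq, one_div_pow, one_div_mul_eq_div]
  -- The diagonal `i = j` is already counted in the exponential sums, so `1 / |V°|` is slack here.
  refine le_add_of_nonneg_of_le (by positivity) ?_
  gcongr
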